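/- Let $M$ be a smooth 3-manifold and let $g(t)$, $t\in J$ ($J\subseteq\mathbb R$ an interval with non-empty interior), be a smooth solution of the Ricci flow $\partial_t g=-2\,\mathrm{Ric}_g$ on $M$. In local coordinates let $R_{ij}$ be the Ricci tensor, $R$ the scalar curvature, $\nabla$ the Levi-Civita connection, $\Delta_g T_{ij}=g^{pq}\nabla_p\nabla_qT_{ij}$, $\langle T,S\rangle_g=g^{ip}g^{jq}T_{ij}S_{pq}$, $|T|_g^2=\langle T,T\rangle_g$, and $\varepsilon^{klm}=\eta^{klm}/\sqrt{\det g}$, where $\eta^{klm}$ is the completely antisymmetric symbol with $\eta^{123}=1$. Let $$C_{ij}=g_{ik}\,\varepsilon^{klm}\Bigl(\nabla_lR_{mj}-\tfrac14(\nabla_lR)\,g_{mj}\Bigr)$$ be the Cotton–York tensor $C_2$ of $g(t)$ in these coordinates. Then in every local coordinate system of $M$, at every point of it and for every $t\in J$ (with one-sided time derivatives at endpoints of $J$ belonging to $J$), $$\begin{aligned} \frac{\partial}{\partial t}C_{ij}={}&\Delta_g C_{ij}-5g^{pq}R_{ip}C_{qj}-5g^{pq}C_{iq}R_{pj}+2\langle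 C_2,\mathrm{Ric}\rangle_g\,g_{ij}+4R\,C_{ij}\\ &+\tfrac12\,g_{ik}g_{jm}\varepsilon^{klm}\nabla_l|\mathrm{Ric}|_g^2+\tfrac R2\,g_{ik}g_{jl}\varepsilon^{klm}\nabla_mR+2\,g_{ik}g^{pq}\varepsilon^{klm}R_{pl}\nabla_mR_{qj}+g_{ik}\varepsilon^{klm}R_{jm}\nabla_lR . \end{aligned}$$ -/

import Mathlib

open scoped Manifold ContDiff

noncomputable section

namespace CottonYork

/-- The model space `ℝ³` of a three-dimensional manifold. -/
abbrev E3 : Type := EuclideanSpace ℝ (Fin 3)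

/-! ### Tensor calculus in a coordinate domain

The components of a metric in a coordinate system are a matrix-valued function `γ : E3 → Mat₃(ℝ)`
of the coordinates. Only its values and derivatives at interior points of the coordinate domain
matter. All sums run over the coordinate indices `0, 1, 2`. -/

/-- The coordinate partial derivative `∂ₖ f`. -/
def pd (k : Fin 3) (f : E3 → ℝ) (y : E3) : ℝ :=
  fderiv ℝ f y (EuclideanSpace.single k (1 : ℝ))

/-- The Christoffel symbols of the Levi-Civita connection,
`Γᵏᵢⱼ = ½ gᵏˡ (∂ᵢ gⱼₗ + ∂ⱼ gᵢₗ - ∂ₗ gᵢⱼ)`. -/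
def christoffel (γ : E3 → Matrix (Fin 3) (Fin 3) ℝ) (k i j : Fin 3) (y : E3) : ℝ :=
  (1 / 2) * ∑ l, (γ y)⁻¹ k l *
    (pd i (fun z => γ z j l) y + pd j (fun z => γ z i l) y - pd l (fun z => γ z i j) y)

/-- The curvature components `Rˡᵢⱼₖ`, where `R(∂ᵢ, ∂ⱼ) ∂ₖ = ∇ᵢ∇ⱼ∂ₖ - ∇ⱼ∇ᵢ∂ₖ = Rˡᵢⱼₖ ∂ₗ`. -/
def riemann (γ : E3 → Matrix (Fin 3) (Fin 3) ℝ) (l i j k : Fin 3) (y : E3) : ℝ :=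
  pd i (christoffel γ l j k) y - pd j (christoffel γ l i k) y
    + ∑ p, (christoffel γ l i p y * christoffel γ p j k y
        - christoffel γ l j p y * christoffel γ p i k y)

/-- The Ricci tensor `Rⱼₖ = Rⁱᵢⱼₖ` (positive on round spheres). -/
def ricci (γ : E3 → Matrix (Fin 3) (Fin 3) ℝ) (j k : Fin 3) (y : E3) : ℝ :=
  ∑ i, riemann γ i i j k y

/-- The scalar curvature `R = gⁱʲ Rᵢⱼ`. -/
def scal (γ : E3 → Matrix (Fin 3) (Fin 3) ℝ) (y : E3) : ℝ :=
  ∑ i, ∑ j, (γ y)⁻¹ i j * ricci γ i j y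

/-- The inner product `⟨T, S⟩ = gⁱᵖ gʲᵠ Tᵢⱼ Sₚᵩ` of two covariant 2-tensors. -/
def inner2 (γ : E3 → Matrix (Fin 3) (Fin 3) ℝ) (T S : Fin 3 → Fin 3 → E3 → ℝ) (y : E3) : ℝ :=
  ∑ i, ∑ j, ∑ p, ∑ q, (γ y)⁻¹ i p * (γ y)⁻¹ j q * T i j y * S p q y

/-- The covariant derivative `∇ₖ Tᵢⱼ` of a covariant 2-tensor. -/
def nabla2 (γ : E3 → Matrix (Fin 3) (Fin 3) ℝ) (T : Fin 3 → Fin 3 → E3 → ℝ)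
    (k i j : Fin 3) (y : E3) : ℝ :=
  pd k (T i j) y
    - ∑ p, christoffel γ p k i y * T p j y - ∑ p, christoffel γ p k j y * T i p y

/-- The covariant derivative `∇ₗ Sₖᵢⱼ` of a covariant 3-tensor. -/
def nabla3 (γ : E3 → Matrix (Fin 3) (Fin 3) ℝ) (S : Fin 3 → Fin 3 → Fin 3 → E3 → ℝ)
    (l k i j : Fin 3) (y : E3) : ℝ :=
  pd l (S k i j) y
    - ∑ p, christoffel γ p l k y * S p i j y
    - ∑ p, christoffel γ p l i y * S k p j y
    - ∑ p, christoffel γ p l j y * S k i p y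

/-- The rough Laplacian `Δ Tᵢⱼ = gᵖᵠ ∇ₚ ∇ᵩ Tᵢⱼ` of a covariant 2-tensor. -/
def laplacian2 (γ : E3 → Matrix (Fin 3) (Fin 3) ℝ) (T : Fin 3 → Fin 3 → E3 → ℝ)
    (i j : Fin 3) (y : E3) : ℝ :=
  ∑ p, ∑ q, (γ y)⁻¹ p q * nabla3 γ (nabla2 γ T) p q i j y

/-- The completely antisymmetric symbol `ηᵏˡᵐ` with `η⁰¹² = 1` (the indices are `0, 1, 2`). -/
def eta (k l m : Fin 3) : ℝ :=
  (((l : ℕ) : ℝ) - ((k : ℕ) : ℝ)) * (((m : ℕ) : ℝ) - ((l : ℕ) : ℝ)) *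
    (((m : ℕ) : ℝ) - ((k : ℕ) : ℝ)) / 2

theorem eta_zero_one_two : eta 0 1 2 = 1 := by
  norm_num [eta]

theorem eta_swap_left (k l m : Fin 3) : eta l k m = -eta k l m := by
  simp only [eta]; ring

theorem eta_swap_right (k l m : Fin 3) : eta k m l = -eta k l m := by
  simp only [eta]; ring

/-- `εᵏˡᵐ = ηᵏˡᵐ / √(det g)` in the given coordinate system. -/
def eps (γ : E3 → Matrix (Fin 3) (Fin 3) ℝ) (k l m : Fin 3) (y : E3) : ℝ :=
  eta k l m / Real.sqrt (γ y).det

/-- The Cotton-York tensor `Cᵢⱼ = gᵢₖ εᵏˡᵐ (∇ₗ Rₘⱼ - ¼ (∇ₗ R) gₘⱼ)`. -/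
def cottonYork (γ : E3 → Matrix (Fin 3) (Fin 3) ℝ) (i j : Fin 3) (y : E3) : ℝ :=
  ∑ k, ∑ l, ∑ m, γ y i k * eps γ k l m y *
    (nabla2 γ (ricci γ) l m j y - (1 / 4) * pd l (scal γ) y * γ y m j)

/-! ### Ricci flow on a three-dimensional manifold -/

section Flow

variable {M : Type*} [TopologicalSpace M] [ChartedSpace E3 M] [IsManifold (𝓡 3) ∞ M]

/-- The components `gᵢⱼ(y) = g(∂ᵢ, ∂ⱼ)` of a smooth Riemannian metric on `M` in the local
coordinate system `e`; the coordinate vector field `∂ᵢ` is the image of the `i`-th standard basis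
vector under the differential of the inverse chart. -/
def metricComp
    (g : Bundle.ContMDiffRiemannianMetric (𝓡 3) ∞ E3 (fun x : M => TangentSpace (𝓡 3) x))
    (e : OpenPartialHomeomorph M E3) (y : E3) : Matrix (Fin 3) (Fin 3) ℝ :=
  Matrix.of fun i j =>
    g.inner (e.symm y)
      (mfderiv (𝓡 3) (𝓡 3) e.symm y (EuclideanSpace.single i (1 : ℝ) : E3))
      (mfderiv (𝓡 3) (𝓡 3) e.symm y (EuclideanSpace.single j (1 : ℝ) : E3))

/-- `g(t)`, `t ∈ J`, is a (smooth) solution of the Ricci flow `∂g/∂t = -2 Ric` on `M`: in every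
local coordinate system of the smooth structure the components of `g(t)` are smooth functions of
time and position jointly, and they satisfy the flow equation. At an endpoint of `J` that belongs
to `J` the time derivative is one-sided. -/
structure IsRicciFlow (J : Set ℝ)
    (g : ℝ → Bundle.ContMDiffRiemannianMetric (𝓡 3) ∞ E3 (fun x : M => TangentSpace (𝓡 3) x)) :
    Prop where
  smooth : ∀ e ∈ IsManifold.maximalAtlas (𝓡 3) ∞ M, ∀ i j : Fin 3,
    ContDiffOn ℝ ∞ (fun p : ℝ × E3 => metricComp (g p.1) e p.2 i j) (J ×ˢ e.target)
  flow : ∀ e ∈ IsManifold.maximalAtlas (𝓡 3) ∞ M, ∀ t ∈ J, ∀ y ∈ e.target, ∀ i j : Fin 3,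
    HasDerivWithinAt (fun s => metricComp (g s) e y i j)
      (-2 * ricci (metricComp (g t) e) i j y) J t

end Flow

end CottonYork

end

/-! The formula is an algebraic identity among derivatives of the metric, so the analysis can be
isolated. Smooth functions on `J ×ˢ e.target` form a commutative `ℝ`-algebra with three space
derivations and one time derivation, all commuting; `MetricData` does tensor calculus over any such
algebra. The flow becomes a single matrix equation `Flow`, and differentiating it gives the
evolution of the connection (`Flow.g_mul_dtΓ`), of Ric (`Flow.dt_ric`) and of ∇Ric (`Flow.dt_dRic`).

The Cotton-York tensor is the `curl` of ∇Ric - ¼ ∇R ⊗ g. As ε is parallel, `curl` commutes with ∇,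
hence with the Laplacian (`cov2_curl`, `lap_curl`). The third derivatives of Ric that occur in
∂ₜ∇Ric are reordered by the Ricci identities; the contracted Bianchi identity then leaves only Δ∇Ric
and commutators (`Flow.map_cov2_dt_ric`). So ∂ₜC - ΔC is, pointwise, bilinear in the curvature and
its first covariant derivative.

Both sides are tensors, so a constant linear change of coordinates (`ConstGL`) makes the metric the
identity matrix at the given point. Normal coordinates are not needed: the Christoffel symbols occur
only inside covariant derivatives. In dimension three the curvature is determined by Ric
(`exists_curvOf`), equivalently by the symmetric matrix b = ½ R g - Ric, and the same holds for each
covariant derivative; the contracted Bianchi identity says that ∇b has zero divergence. What remains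
is the polynomial identity `evolution_core`. `Flow.map_dt_cotton` assembles these facts,
`Flow.dt_cotton` returns to an arbitrary metric, and the `IsSlice` lemmas translate the result back
to coordinate formulas. -/

namespace CottonYork

open Matrix

/-! ### Entrywise derivations of matrices. -/

section MatrixDerivation

variable {A : Type*} [CommRing A] [Algebra ℝ A]

/-- Entrywise application of a derivation to a matrix. -/
def mapDer (δ : Derivation ℝ A A) (X : Matrix (Fin 3) (Fin 3) A) : Matrix (Fin 3) (Fin 3) A :=
  X.map δ

variable (δ : Derivation ℝ A A) (X Y : Matrix (Fin 3) (Fin 3) A)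

@[simp] theorem mapDer_apply (i j : Fin 3) : mapDer δ X i j = δ (X i j) := rfl

theorem mapDer_add : mapDer δ (X + Y) = mapDer δ X + mapDer δ Y := by ext; simp

theorem mapDer_sub : mapDer δ (X - Y) = mapDer δ X - mapDer δ Y := by ext; simp

theorem mapDer_neg : mapDer δ (-X) = -mapDer δ X := by ext; simp

theorem mapDer_zero : mapDer δ 0 = 0 := by ext; simp

theorem mapDer_one : mapDer δ 1 = 0 := by
  ext i j
  by_cases h : i = j <;> simp [h]

theorem mapDer_transpose : mapDer δ Xᵀ = (mapDer δ X)ᵀ := rfl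

theorem mapDer_mul : mapDer δ (X * Y) = mapDer δ X * Y + X * mapDer δ Y := by
  ext i j
  simp only [mapDer_apply, Matrix.mul_apply, Matrix.add_apply, map_sum, Derivation.leibniz,
    smul_eq_mul, ← Finset.sum_add_distrib]
  exact Finset.sum_congr rfl fun _ _ => by ring

theorem mapDer_smul (a : A) : mapDer δ (a • X) = δ a • X + a • mapDer δ X := by
  ext i j
  simp only [mapDer_apply, Matrix.smul_apply, Matrix.add_apply, Derivation.leibniz, smul_eq_mul]
  ring

theorem mapDer_sum (f : Fin 3 → Matrix (Fin 3) (Fin 3) A) :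
    mapDer δ (∑ p, f p) = ∑ p, mapDer δ (f p) := by
  ext i j
  simp [Matrix.sum_apply]

theorem mapDer_comm {δ δ' : Derivation ℝ A A} (h : ∀ f, δ (δ' f) = δ' (δ f)) :
    mapDer δ (mapDer δ' X) = mapDer δ' (mapDer δ X) := by
  ext; simp [h]

end MatrixDerivation

/-- Three commuting space derivations and a time derivation of an algebra of functions, together
with the components of a metric, its inverse, its Levi-Civita connection
(`Γ i` is the matrix `(Γᵏᵢⱼ)ₖⱼ`) and the factor `w = ± 1 / √(det g)`. -/
structure MetricData (A : Type*) [CommRing A] [Algebra ℝ A] where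
  d : Fin 3 → Derivation ℝ A A
  dt : Derivation ℝ A A
  d_comm : ∀ i j f, d i (d j f) = d j (d i f)
  dt_comm : ∀ i f, dt (d i f) = d i (dt f)
  g : Matrix (Fin 3) (Fin 3) A
  gi : Matrix (Fin 3) (Fin 3) A
  Γ : Fin 3 → Matrix (Fin 3) (Fin 3) A
  w : A
  g_symm : gᵀ = g
  g_mul_gi : g * gi = 1
  Γ_symm : ∀ i j k, Γ i k j = Γ j k i
  compat : ∀ k, mapDer (d k) g = (Γ k)ᵀ * g + g * Γ k
  w_sq : w * w * g.det = 1

/-! ### Tensor calculus over an algebra with derivations. -/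

namespace MetricData

variable {A : Type*} [CommRing A] [Algebra ℝ A] (D : MetricData A)

theorem gi_mul_g : D.gi * D.g = 1 := mul_eq_one_comm.mp D.g_mul_gi

theorem gi_symm : D.giᵀ = D.gi := by
  have h : D.giᵀ * D.g = 1 := by
    have := congrArg Matrix.transpose D.g_mul_gi
    rwa [Matrix.transpose_mul, D.g_symm, Matrix.transpose_one] at this
  calc D.giᵀ = D.giᵀ * (D.g * D.gi) := by rw [D.g_mul_gi, mul_one]
    _ = D.gi := by rw [← mul_assoc, h, one_mul]

theorem gi_symm_apply (i j : Fin 3) : D.gi i j = D.gi j i := by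
  conv_lhs => rw [← D.gi_symm]
  rfl

theorem g_symm_apply (i j : Fin 3) : D.g i j = D.g j i := by
  conv_lhs => rw [← D.g_symm]
  rfl

theorem mapDer_gi (δ : Derivation ℝ A A) : mapDer δ D.gi = -(D.gi * mapDer δ D.g * D.gi) := by
  have h := congrArg (mapDer δ) D.g_mul_gi
  rw [mapDer_mul, mapDer_one] at h
  have h2 : mapDer δ D.gi = D.gi * (D.g * mapDer δ D.gi) := by
    rw [← mul_assoc, D.gi_mul_g, one_mul]
  rw [h2, eq_neg_of_add_eq_zero_right h]
  noncomm_ring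

theorem compat_gi (k : Fin 3) :
    mapDer (D.d k) D.gi = -(D.Γ k * D.gi) - D.gi * (D.Γ k)ᵀ := by
  rw [mapDer_gi, D.compat]
  calc _ = -(D.gi * (D.Γ k)ᵀ * (D.g * D.gi)) - (D.gi * D.g) * D.Γ k * D.gi := by noncomm_ring
    _ = _ := by rw [D.g_mul_gi, D.gi_mul_g]; noncomm_ring

/-! ### Covariant derivatives and curvature -/

/-- Covariant derivative of a covariant 2-tensor in the direction `k`. -/
def cov2 (k : Fin 3) (X : Matrix (Fin 3) (Fin 3) A) : Matrix (Fin 3) (Fin 3) A :=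
  mapDer (D.d k) X - (D.Γ k)ᵀ * X - X * D.Γ k

/-- Covariant derivative `∇ₗ Sₖ` of a covariant 3-tensor. -/
def cov3 (S : Fin 3 → Matrix (Fin 3) (Fin 3) A) (l k : Fin 3) : Matrix (Fin 3) (Fin 3) A :=
  D.cov2 l (S k) - ∑ p, D.Γ l p k • S p

/-- Covariant derivative `∇ₐ Xₗₖ` of a covariant 4-tensor. -/
def cov4 (X : Fin 3 → Fin 3 → Matrix (Fin 3) (Fin 3) A) (a l k : Fin 3) :
    Matrix (Fin 3) (Fin 3) A :=
  D.cov2 a (X l k) - ∑ p, D.Γ a p l • X p k - ∑ p, D.Γ a p k • X l p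

/-- The curvature matrices `(Rˡᵢⱼₖ)ₗₖ`. -/
def rm (i j : Fin 3) : Matrix (Fin 3) (Fin 3) A :=
  mapDer (D.d i) (D.Γ j) - mapDer (D.d j) (D.Γ i) + D.Γ i * D.Γ j - D.Γ j * D.Γ i

/-- Covariant derivative of the curvature. -/
def covRm (a i j : Fin 3) : Matrix (Fin 3) (Fin 3) A :=
  mapDer (D.d a) (D.rm i j) + D.Γ a * D.rm i j - D.rm i j * D.Γ a
    - ∑ p, D.Γ a p i • D.rm p j - ∑ p, D.Γ a p j • D.rm i p

/-- The Ricci tensor. -/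
def ric : Matrix (Fin 3) (Fin 3) A := Matrix.of fun j k => ∑ i, D.rm i j i k

theorem rm_swap (i j : Fin 3) : D.rm j i = -D.rm i j := by
  simp only [rm]; abel

theorem cov2_add (k : Fin 3) (X Y : Matrix (Fin 3) (Fin 3) A) :
    D.cov2 k (X + Y) = D.cov2 k X + D.cov2 k Y := by
  simp only [cov2, mapDer_add]; noncomm_ring

theorem cov2_sub (k : Fin 3) (X Y : Matrix (Fin 3) (Fin 3) A) :
    D.cov2 k (X - Y) = D.cov2 k X - D.cov2 k Y := by
  simp only [cov2, mapDer_sub]; noncomm_ring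

theorem cov2_zero (k : Fin 3) : D.cov2 k 0 = 0 := by
  simp [cov2, mapDer_zero]

theorem cov2_smul (k : Fin 3) (a : A) (X : Matrix (Fin 3) (Fin 3) A) :
    D.cov2 k (a • X) = D.d k a • X + a • D.cov2 k X := by
  simp only [cov2, mapDer_smul, smul_sub, Matrix.mul_smul, Matrix.smul_mul]; abel

theorem cov2_sum (k : Fin 3) (f : Fin 3 → Matrix (Fin 3) (Fin 3) A) :
    D.cov2 k (∑ p, f p) = ∑ p, D.cov2 k (f p) := by
  simp only [Fin.sum_univ_three, cov2_add]

theorem cov2_g (k : Fin 3) : D.cov2 k D.g = 0 := by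
  simp only [cov2, D.compat]; abel

/-- The inverse metric is parallel, so the Leibniz rule has no middle term. -/
theorem cov2_mul_gi_mul (k : Fin 3) (X Y : Matrix (Fin 3) (Fin 3) A) :
    D.cov2 k (X * D.gi * Y) = D.cov2 k X * D.gi * Y + X * D.gi * D.cov2 k Y := by
  simp only [cov2, mapDer_mul, D.compat_gi]
  noncomm_ring

theorem cov2_transpose (k : Fin 3) (X : Matrix (Fin 3) (Fin 3) A) :
    D.cov2 k Xᵀ = (D.cov2 k X)ᵀ := by
  simp only [cov2, mapDer_transpose, Matrix.transpose_sub, Matrix.transpose_mul,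
    Matrix.transpose_transpose]
  abel

/-- The Ricci identity for 2-tensors, with frozen derivative directions. -/
theorem cov2_comm (k l : Fin 3) (X : Matrix (Fin 3) (Fin 3) A) :
    D.cov2 k (D.cov2 l X) - D.cov2 l (D.cov2 k X) = -((D.rm k l)ᵀ * X) - X * D.rm k l := by
  have h := mapDer_comm X (D.d_comm k l)
  simp only [cov2, rm, mapDer_sub, mapDer_mul, mapDer_transpose, Matrix.transpose_sub,
    Matrix.transpose_add, Matrix.transpose_mul, h]
  noncomm_ring

/-- Absence of torsion: the connection term on a derivative index is symmetric, so it drops out of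
every commutator of covariant derivatives. -/
theorem sum_Γ_swap (k l : Fin 3) (S : Fin 3 → Matrix (Fin 3) (Fin 3) A) :
    ∑ p, D.Γ k p l • S p = ∑ p, D.Γ l p k • S p :=
  Finset.sum_congr rfl fun p _ => by rw [D.Γ_symm]

/-- The Ricci identity for 2-tensors. -/
theorem cov3_cov2_comm (k l : Fin 3) (X : Matrix (Fin 3) (Fin 3) A) :
    D.cov3 (fun m => D.cov2 m X) k l - D.cov3 (fun m => D.cov2 m X) l k
      = -((D.rm k l)ᵀ * X) - X * D.rm k l := by
  rw [← cov2_comm]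
  simp only [cov3]
  rw [D.sum_Γ_swap k l]
  abel

theorem rm_apply (i j l k : Fin 3) : D.rm i j l k =
    D.d i (D.Γ j l k) - D.d j (D.Γ i l k) + ∑ p, D.Γ i l p * D.Γ j p k
      - ∑ p, D.Γ j l p * D.Γ i p k := by
  simp [rm, Matrix.mul_apply]

/-- The Ricci identity for 3-tensors. -/
theorem cov4_cov3_comm (a b c : Fin 3) (S : Fin 3 → Matrix (Fin 3) (Fin 3) A) :
    D.cov4 (D.cov3 S) a b c - D.cov4 (D.cov3 S) b a c
      = -((D.rm a b)ᵀ * S c) - S c * D.rm a b - ∑ p, D.rm a b p c • S p := by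
  rw [← cov2_comm]
  simp only [cov4, cov3, cov2_sub, cov2_sum, cov2_smul, rm_apply]
  rw [D.sum_Γ_swap a b]
  simp only [Fin.sum_univ_three]
  module

/-- The second Bianchi identity. -/
theorem bianchi (a b c : Fin 3) : D.covRm a b c + D.covRm b c a + D.covRm c a b = 0 := by
  -- By symmetry of Γ and antisymmetry of the curvature, the connection terms on the form indices
  -- cancel in pairs over the cyclic sum. The rest is a Jacobi identity.
  have h : ∀ i j k, ∑ p, D.Γ i p j • D.rm p k = -∑ p, D.Γ j p i • D.rm k p := fun i j k => by
    rw [← Finset.sum_neg_distrib]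
    exact Finset.sum_congr rfl fun p _ => by rw [D.rm_swap k p, smul_neg, D.Γ_symm]
  simp only [covRm]
  rw [h a b c, h b c a, h c a b]
  simp only [rm, mapDer_sub, mapDer_add, mapDer_mul]
  rw [mapDer_comm (D.Γ c) (D.d_comm a b), mapDer_comm (D.Γ b) (D.d_comm a c),
    mapDer_comm (D.Γ a) (D.d_comm b c)]
  noncomm_ring

theorem covRm_swap (a i j : Fin 3) : D.covRm a j i = -D.covRm a i j := by
  simp only [covRm, D.rm_swap i j, fun p => D.rm_swap p j, D.rm_swap i, smul_neg,
    Finset.sum_neg_distrib, mapDer_neg]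
  noncomm_ring

/-- This is the Ricci identity applied to the parallel tensor g. -/
theorem g_mul_rm (i j : Fin 3) : (D.rm i j)ᵀ * D.g = -(D.g * D.rm i j) := by
  have h := D.cov2_comm i j D.g
  simp only [cov2_g, cov2_zero, sub_zero] at h
  rw [eq_neg_iff_add_eq_zero, ← neg_eq_zero, neg_add']
  exact h.symm

theorem g_mul_covRm (a i j : Fin 3) : (D.covRm a i j)ᵀ * D.g = -(D.g * D.covRm a i j) := by
  have h := congrArg (mapDer (D.d a)) (D.g_mul_rm i j)
  simp only [mapDer_mul, mapDer_neg, mapDer_transpose, D.compat] at h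
  have h1 := D.g_mul_rm i j
  rw [← add_eq_zero_iff_eq_neg] at h h1 ⊢
  have e1 := congrArg (fun x => (D.Γ a)ᵀ * x) h1
  have e2 := congrArg (fun x => x * D.Γ a) h1
  have e3 : (∑ p, D.Γ a p i • D.rm p j)ᵀ * D.g + D.g * ∑ p, D.Γ a p i • D.rm p j = 0 := by
    simp only [Matrix.transpose_sum, Finset.sum_mul, Finset.mul_sum, Matrix.transpose_smul,
      Matrix.smul_mul, Matrix.mul_smul, g_mul_rm, smul_neg, Finset.sum_neg_distrib]
    abel
  have e4 : (∑ p, D.Γ a p j • D.rm i p)ᵀ * D.g + D.g * ∑ p, D.Γ a p j • D.rm i p = 0 := by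
    simp only [Matrix.transpose_sum, Finset.sum_mul, Finset.mul_sum, Matrix.transpose_smul,
      Matrix.smul_mul, Matrix.mul_smul, g_mul_rm, smul_neg, Finset.sum_neg_distrib]
    abel
  simp only [mul_zero, zero_mul] at e1 e2
  simp only [covRm, Matrix.transpose_sub, Matrix.transpose_add, Matrix.transpose_mul]
  linear_combination (norm := noncomm_ring) h - e1 - e2 - e3 - e4

/-! ### Contractions with the inverse metric -/

/-- The metric contraction `gᵖᵠ Xₚᵩ`. -/
def contract (X : Matrix (Fin 3) (Fin 3) A) : A := ∑ p, ∑ q, D.gi p q * X p q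

/-- Covariant derivative of a covariant 4-tensor, in components. -/
def covComp (T : Fin 3 → Fin 3 → Fin 3 → Fin 3 → A) (a b c e f : Fin 3) : A :=
  D.d a (T b c e f) - ∑ p, D.Γ a p b * T p c e f - ∑ p, D.Γ a p c * T b p e f
    - ∑ p, D.Γ a p e * T b c p f - ∑ p, D.Γ a p f * T b c e p

theorem cov2_apply (k : Fin 3) (X : Matrix (Fin 3) (Fin 3) A) (i j : Fin 3) :
    D.cov2 k X i j = D.d k (X i j) - ∑ p, D.Γ k p i * X p j - ∑ p, D.Γ k p j * X i p := by
  simp [cov2, Matrix.mul_apply, mul_comm]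

theorem cov3_apply (S : Fin 3 → Matrix (Fin 3) (Fin 3) A) (l k i j : Fin 3) :
    D.cov3 S l k i j = D.d l (S k i j) - ∑ p, D.Γ l p k * S p i j - ∑ p, D.Γ l p i * S k p j
      - ∑ p, D.Γ l p j * S k i p := by
  simp only [cov3, Matrix.sub_apply, cov2_apply, Matrix.sum_apply, Matrix.smul_apply, smul_eq_mul]
  ring

theorem cov4_apply (X : Fin 3 → Fin 3 → Matrix (Fin 3) (Fin 3) A) (a b c e f : Fin 3) :
    D.cov4 X a b c e f = D.covComp (fun b c e f => X b c e f) a b c e f := by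
  simp only [cov4, covComp, Matrix.sub_apply, cov2_apply, Matrix.sum_apply, Matrix.smul_apply,
    smul_eq_mul]
  ring

/-- The inverse metric is parallel, so metric traces commute with ∇. The following variants carry
extra free indices. -/
theorem d_contract (a : Fin 3) (X : Matrix (Fin 3) (Fin 3) A) :
    D.d a (D.contract X) = D.contract (D.cov2 a X) := by
  have h : ∀ p q, D.d a (D.gi p q) = -∑ r, D.Γ a p r * D.gi r q - ∑ r, D.gi p r * D.Γ a q r :=
    fun p q => by
      have := congrFun (congrFun (D.compat_gi a) p) q
      simpa [Matrix.mul_apply] using this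
  simp only [contract, map_add, Derivation.leibniz, smul_eq_mul, h, cov2_apply,
    Fin.sum_univ_three]
  ring

theorem cov2_contract (T : Fin 3 → Fin 3 → Fin 3 → Fin 3 → A) (a e f : Fin 3) :
    D.cov2 a (Matrix.of fun e f => D.contract (Matrix.of fun b c => T b c e f)) e f
      = D.contract (Matrix.of fun b c => D.covComp T a b c e f) := by
  rw [cov2_apply]
  simp only [Matrix.of_apply]
  rw [d_contract]
  simp only [contract, cov2_apply, covComp, Matrix.of_apply, Fin.sum_univ_three]
  ring

theorem d_contract_first (S : Fin 3 → Matrix (Fin 3) (Fin 3) A) (a j : Fin 3) :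
    D.d a (D.contract (Matrix.of fun p q => S p q j))
        - ∑ r, D.Γ a r j * D.contract (Matrix.of fun p q => S p q r)
      = D.contract (Matrix.of fun p q => D.cov3 S a p q j) := by
  rw [d_contract]
  simp only [contract, cov2_apply, cov3_apply, Matrix.of_apply, Fin.sum_univ_three]
  ring

theorem d_contract_last (S : Fin 3 → Matrix (Fin 3) (Fin 3) A) (a j : Fin 3) :
    D.d a (D.contract (S j)) - ∑ r, D.Γ a r j * D.contract (S r)
      = D.contract (D.cov3 S a j) := by
  rw [d_contract]
  simp only [contract, cov2_apply, cov3_apply, Fin.sum_univ_three]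
  ring

/-- The scalar curvature. -/
def scal : A := D.contract D.ric

/-- The covariant derivative of the Ricci tensor. -/
def dRic (k : Fin 3) : Matrix (Fin 3) (Fin 3) A := D.cov2 k D.ric

/-- The second covariant derivative of the Ricci tensor. -/
def ddRic (l k : Fin 3) : Matrix (Fin 3) (Fin 3) A := D.cov3 D.dRic l k

/-- The third covariant derivative of the Ricci tensor. -/
def dddRic (a l k : Fin 3) : Matrix (Fin 3) (Fin 3) A := D.cov4 D.ddRic a l k

/-- The trace defining Ric pairs an upper index with a lower one, so it commutes with ∇ without any
use of the metric. -/
theorem dRic_apply (a j k : Fin 3) : D.dRic a j k = ∑ i, D.covRm a i j i k := by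
  simp only [dRic, cov2_apply, ric, covRm, Matrix.of_apply, Matrix.sub_apply, Matrix.add_apply,
    mapDer_apply, Matrix.mul_apply, Matrix.smul_apply, smul_eq_mul, map_add,
    Fin.sum_univ_three]
  ring

theorem gi_covRm (a i j p q : Fin 3) :
    ∑ k, D.covRm a i j p k * D.gi k q = -∑ k, D.covRm a i j q k * D.gi k p := by
  have h : D.covRm a i j * D.gi = -(D.covRm a i j * D.gi)ᵀ := by
    rw [Matrix.transpose_mul, D.gi_symm]
    calc D.covRm a i j * D.gi = D.gi * (D.g * D.covRm a i j) * D.gi := by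
          rw [← mul_assoc, D.gi_mul_g, one_mul]
      _ = -(D.gi * (D.covRm a i j)ᵀ * (D.g * D.gi)) := by
          rw [eq_neg_of_add_eq_zero_right (add_eq_zero_iff_eq_neg.mpr (D.g_mul_covRm a i j))]
          noncomm_ring
      _ = _ := by rw [D.g_mul_gi, mul_one]
  have := congrFun (congrFun h p) q
  rwa [Matrix.neg_apply, Matrix.transpose_apply, Matrix.mul_apply, Matrix.mul_apply] at this

/-- The contracted second Bianchi identity `∇ᵖ Rₚⱼ = ½ ∇ⱼ R`. -/
theorem contracted_bianchi (m : Fin 3) :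
    2 * D.contract (Matrix.of fun p q => D.dRic p m q) = D.contract (D.dRic m) := by
  -- The second Bianchi identity traced once, over its upper index and one form index.
  have h1 : ∀ j k, D.dRic m j k - D.dRic j m k + ∑ i, D.covRm i j m i k = 0 := fun j k => by
    have h : ∑ i, (D.covRm i j m i k + D.covRm j m i i k + D.covRm m i j i k) = 0 :=
      Finset.sum_eq_zero fun i _ => by
        have := congrFun (congrFun (D.bianchi i j m) i) k
        simpa using this
    simp only [Finset.sum_add_distrib] at h
    rw [dRic_apply, dRic_apply]
    have h' : ∑ i, D.covRm j m i i k = -∑ i, D.covRm j i m i k := by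
      rw [← Finset.sum_neg_distrib]
      exact Finset.sum_congr rfl fun i _ => by rw [D.covRm_swap j i m]; rfl
    rw [h'] at h
    linear_combination h
  -- Second trace: skewness of the raised curvature exchanges the roles of `i` and `j`, and the
  -- divergence of Rm becomes minus the divergence of Ric.
  have h2 : ∑ j, ∑ k, D.gi j k * ∑ i, D.covRm i j m i k
      = -D.contract (Matrix.of fun p q => D.dRic p m q) := by
    have h3 : ∀ i j, ∑ k, D.gi j k * D.covRm i j m i k
        = -∑ k, D.gi i k * D.covRm i j m j k := fun i j => by
      have := D.gi_covRm i j m i j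
      simp only [D.gi_symm_apply _ i, D.gi_symm_apply _ j] at this
      simpa only [mul_comm] using this
    simp only [contract, Matrix.of_apply, dRic_apply, Finset.mul_sum]
    have h4 : ∀ j, ∑ k, ∑ i, D.gi j k * D.covRm i j m i k
        = ∑ i, -∑ k, D.gi i k * D.covRm i j m j k := fun j => by
      rw [Finset.sum_comm]
      exact Finset.sum_congr rfl fun i _ => h3 i j
    simp only [h4, Finset.sum_neg_distrib, neg_inj]
    rw [Finset.sum_comm]
    exact Finset.sum_congr rfl fun i _ => Finset.sum_comm
  have h5 : ∑ j, ∑ k, D.gi j k * (D.dRic m j k - D.dRic j m k + ∑ i, D.covRm i j m i k) = 0 :=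
    Finset.sum_eq_zero fun j _ => Finset.sum_eq_zero fun k _ => by rw [h1, mul_zero]
  simp only [mul_add, mul_sub, Finset.sum_add_distrib, Finset.sum_sub_distrib, h2] at h5
  simp only [contract, Matrix.of_apply] at h5 ⊢
  linear_combination -h5

end MetricData
end CottonYork

namespace CottonYork

open Matrix

namespace MetricData

variable {A : Type*} [CommRing A] [Algebra ℝ A] (D : MetricData A)

/-! ### The Ricci identity for the derivatives of the Ricci tensor -/

theorem dddRic_comm_left (a b c : Fin 3) :
    D.dddRic a b c - D.dddRic b a c
      = -((D.rm a b)ᵀ * D.dRic c) - D.dRic c * D.rm a b - ∑ p, D.rm a b p c • D.dRic p :=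
  D.cov4_cov3_comm a b c D.dRic

theorem cov4_swap (X : Fin 3 → Fin 3 → Matrix (Fin 3) (Fin 3) A) (a b c : Fin 3) :
    D.cov4 (fun b c => X c b) a b c = D.cov4 X a c b := by
  simp only [cov4]; abel

theorem cov4_sub (X Y : Fin 3 → Fin 3 → Matrix (Fin 3) (Fin 3) A) (a b c : Fin 3) :
    D.cov4 (fun b c => X b c - Y b c) a b c = D.cov4 X a b c - D.cov4 Y a b c := by
  simp only [cov4, cov2_sub, smul_sub, Finset.sum_sub_distrib]; abel

/-- Leibniz rule for the right-hand side of the Ricci identity. Since `cov4` also differentiates the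
indices `b`, `c`, the derivative of the curvature is the full `covRm`. -/
theorem cov4_rm_mul (a b c : Fin 3) (X : Matrix (Fin 3) (Fin 3) A) :
    D.cov4 (fun b c => -((D.rm b c)ᵀ * X) - X * D.rm b c) a b c
      = -((D.covRm a b c)ᵀ * X) - X * D.covRm a b c
        - (D.rm b c)ᵀ * D.cov2 a X - D.cov2 a X * D.rm b c := by
  simp only [cov4, cov2, covRm, mapDer_sub, mapDer_neg, mapDer_mul, mapDer_transpose,
    Matrix.transpose_sub, Matrix.transpose_add, Matrix.transpose_mul,
    Matrix.transpose_smul, Fin.sum_univ_three, add_mul, mul_add, sub_mul, mul_sub, smul_sub,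
    smul_neg, Matrix.smul_mul, Matrix.mul_smul]
  noncomm_ring

theorem dddRic_comm_right (a b c : Fin 3) :
    D.dddRic a b c - D.dddRic a c b
      = -((D.covRm a b c)ᵀ * D.ric) - D.ric * D.covRm a b c
        - (D.rm b c)ᵀ * D.dRic a - D.dRic a * D.rm b c := by
  have h : (fun b c => D.ddRic b c - D.ddRic c b)
      = fun b c => -((D.rm b c)ᵀ * D.ric) - D.ric * D.rm b c :=
    funext fun b => funext fun c => D.cov3_cov2_comm b c D.ric
  have h2 := D.cov4_sub D.ddRic (fun b c => D.ddRic c b) a b c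
  rw [h, cov4_rm_mul, D.cov4_swap D.ddRic a b c] at h2
  exact h2.symm

/-! ### Evolution of the connection and the Ricci tensor -/

/-- Two is invertible in an `ℝ`-algebra; this lets polarisation arguments run without fractions. -/
theorem two_mul_inj {x y : A} (h : 2 * x = 2 * y) : x = y := by
  have h2 : algebraMap ℝ A (1 / 2) * 2 = 1 := by
    rw [← map_ofNat (algebraMap ℝ A) 2, ← map_mul]; norm_num
  calc x = algebraMap ℝ A (1 / 2) * (2 * x) := by rw [← mul_assoc, h2, one_mul]
    _ = y := by rw [h, ← mul_assoc, h2, one_mul]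

/-- The Ricci flow equation. -/
def Flow : Prop := mapDer D.dt D.g = (-2 : A) • D.ric

variable {D}

/-- Symmetry is read off the flow equation, as ∂ₜg is symmetric; the first Bianchi identity is not
needed. -/
theorem Flow.ric_symm (hD : D.Flow) : D.ricᵀ = D.ric := by
  have h := congrArg Matrix.transpose hD
  rw [← mapDer_transpose, D.g_symm, hD] at h
  ext i j
  have := congrFun (congrFun h i) j
  simp only [Matrix.smul_apply, Matrix.transpose_apply, smul_eq_mul] at this ⊢
  exact two_mul_inj (by linear_combination this)

theorem Flow.dRic_symm (hD : D.Flow) (k i j : Fin 3) : D.dRic k i j = D.dRic k j i := by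
  have := congrFun (congrFun (D.cov2_transpose k D.ric) j) i
  rw [hD.ric_symm] at this
  exact this.symm

variable (D) in
/-- The lowered time derivative of the Christoffel symbols under Ricci flow. -/
def dtΓLow (j : Fin 3) : Matrix (Fin 3) (Fin 3) A :=
  Matrix.of fun l k => D.dRic l j k - D.dRic j l k - D.dRic k l j

/-- The Koszul argument, one derivative later: applying ∂ₜ to metric compatibility gives the
symmetric part of g ∂ₜΓ as a multiple of ∇Ric, and three index permutations together with symmetry
in the lower indices isolate g ∂ₜΓ itself. -/
theorem Flow.g_mul_dtΓ (hD : D.Flow) (j : Fin 3) :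
    D.g * mapDer D.dt (D.Γ j) = D.dtΓLow j := by
  have h : ∀ k, (-2 : A) • D.dRic k
      = (D.g * mapDer D.dt (D.Γ k))ᵀ + D.g * mapDer D.dt (D.Γ k) := fun k => by
    have h := congrArg (mapDer D.dt) (D.compat k)
    rw [mapDer_comm D.g (D.dt_comm k), mapDer_add, mapDer_mul, mapDer_mul, mapDer_transpose,
      hD] at h
    have h2 : (-2 : A) • D.dRic k = D.cov2 k ((-2 : A) • D.ric) := by
      have : D.d k (-2 : A) = 0 := by
        rw [map_neg, ← Nat.cast_ofNat (n := 2), Derivation.map_natCast, neg_zero]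
      rw [cov2_smul, this, zero_smul, zero_add, dRic]
    rw [h2, cov2, h, Matrix.transpose_mul, D.g_symm]
    noncomm_ring
  have hs : ∀ i l k, (D.g * mapDer D.dt (D.Γ i)) l k = (D.g * mapDer D.dt (D.Γ k)) l i :=
    fun i l k => by simp only [Matrix.mul_apply, mapDer_apply, D.Γ_symm i]
  have h' : ∀ k l j, -2 * D.dRic k l j
      = (D.g * mapDer D.dt (D.Γ k)) j l + (D.g * mapDer D.dt (D.Γ k)) l j := fun k l j => by
    have := congrFun (congrFun (h k) l) j
    simpa only [Matrix.smul_apply, Matrix.add_apply, Matrix.transpose_apply, smul_eq_mul] using this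
  ext l k
  apply two_mul_inj
  simp only [dtΓLow, Matrix.of_apply]
  have e1 := h' j l k
  have e2 := h' k l j
  have e3 := h' l j k
  rw [hs j k l] at e1
  rw [hs k j l, hs k l j] at e2
  linear_combination e3 - e1 - e2

theorem Flow.dtΓ (hD : D.Flow) (j : Fin 3) : mapDer D.dt (D.Γ j) = D.gi * D.dtΓLow j := by
  rw [← hD.g_mul_dtΓ, ← mul_assoc, D.gi_mul_g, one_mul]

/-- The variation of a connection is a tensor, and the variation of the curvature is its
antisymmetrised covariant derivative; the inverse metric passes through because it is parallel. -/
theorem dt_rm (i j : Fin 3) (Y : Fin 3 → Matrix (Fin 3) (Fin 3) A)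
    (hY : ∀ j, mapDer D.dt (D.Γ j) = D.gi * Y j) :
    mapDer D.dt (D.rm i j) = D.gi * (D.cov3 Y i j - D.cov3 Y j i) := by
  simp only [rm, mapDer_sub, mapDer_add, mapDer_mul, mapDer_comm _ (D.dt_comm _), hY, cov3, cov2,
    D.sum_Γ_swap i j, D.compat_gi]
  noncomm_ring

variable (D) in
/-- The 4-tensor whose metric contraction is the time derivative of the Ricci tensor. -/
def dtRicTensor (i l j k : Fin 3) : A :=
  D.ddRic i l j k - D.ddRic i j l k - D.ddRic i k l j
    - D.ddRic j l i k + D.ddRic j i l k + D.ddRic j k l i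

theorem Flow.dt_ric (hD : D.Flow) :
    mapDer D.dt D.ric
      = Matrix.of fun j k => D.contract (Matrix.of fun i l => D.dtRicTensor i l j k) := by
  ext j k
  have h : ∀ i j l k, D.cov3 D.dtΓLow i j l k
      = D.ddRic i l j k - D.ddRic i j l k - D.ddRic i k l j := fun i j l k => by
    simp only [ddRic, cov3_apply, dtΓLow, Matrix.of_apply, map_sub, Fin.sum_univ_three]
    ring
  have h2 : ∀ i, D.dt (D.rm i j i k) = ∑ l, D.gi i l * D.dtRicTensor i l j k := fun i => by
    have := congrFun (congrFun (dt_rm i j D.dtΓLow hD.dtΓ) i) k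
    simp only [Matrix.mul_apply, mapDer_apply, Matrix.sub_apply, h] at this
    rw [this]
    exact Finset.sum_congr rfl fun l _ => by rw [dtRicTensor]; ring
  simp only [mapDer_apply, ric, Matrix.of_apply, map_sum, h2, contract]

theorem Flow.cov2_dt_ric (hD : D.Flow) (a j k : Fin 3) :
    D.cov2 a (mapDer D.dt D.ric) j k = D.contract (Matrix.of fun i l =>
      D.dddRic a i l j k - D.dddRic a i j l k - D.dddRic a i k l j
        - D.dddRic a j l i k + D.dddRic a j i l k + D.dddRic a j k l i) := by
  rw [hD.dt_ric, cov2_contract]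
  congr 1
  ext i l
  simp only [Matrix.of_apply, dddRic, cov4_apply, covComp, dtRicTensor, map_sub, map_add,
    Fin.sum_univ_three]
  ring

theorem Flow.dt_dRic (hD : D.Flow) (a : Fin 3) :
    mapDer D.dt (D.dRic a) = D.cov2 a (mapDer D.dt D.ric)
      - (D.gi * D.dtΓLow a)ᵀ * D.ric - D.ric * (D.gi * D.dtΓLow a) := by
  simp only [dRic, cov2, mapDer_sub, mapDer_mul, mapDer_transpose, mapDer_comm _ (D.dt_comm _),
    hD.dtΓ]
  noncomm_ring

/-! ### Derivatives of the contracted Bianchi identity -/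

theorem Flow.contract_dRic (hD : D.Flow) (m : Fin 3) :
    2 * D.contract (Matrix.of fun p q => D.dRic p q m) = D.contract (D.dRic m) := by
  rw [← D.contracted_bianchi m]
  congr 2
  ext p q
  exact hD.dRic_symm p q m

theorem Flow.contract_ddRic (hD : D.Flow) (a m : Fin 3) :
    2 * D.contract (Matrix.of fun p q => D.ddRic a p q m) = D.contract (D.ddRic a m) := by
  have h1 := D.d_contract_first D.dRic a m
  have h2 := D.d_contract_last D.dRic a m
  have h3 := congrArg (D.d a) (hD.contract_dRic m)
  rw [two_mul, map_add] at h3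
  simp only [ddRic, ← h1, ← h2]
  simp only [Fin.sum_univ_three]
  linear_combination h3 - D.Γ a 0 m * hD.contract_dRic 0 - D.Γ a 1 m * hD.contract_dRic 1
    - D.Γ a 2 m * hD.contract_dRic 2

theorem Flow.contract_dddRic (hD : D.Flow) (a b m : Fin 3) :
    2 * D.contract (Matrix.of fun p q => D.dddRic a b p q m) = D.contract (D.dddRic a b m) := by
  have h1 := D.cov2_contract (fun p q b m => D.ddRic b p q m) a b m
  have h2 := D.cov2_contract (fun p q b m => D.ddRic b m p q) a b m
  -- The factor 2 is written as a sum so that additivity of `cov2` applies directly.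
  have h3 : (Matrix.of fun b m => D.contract (Matrix.of fun p q => D.ddRic b p q m))
      + (Matrix.of fun b m => D.contract (Matrix.of fun p q => D.ddRic b p q m))
      = Matrix.of fun b m => D.contract (Matrix.of fun p q => D.ddRic b m p q) := by
    ext b m
    have := hD.contract_ddRic b m
    rw [two_mul] at this
    exact this
  have h4 := congrFun (congrFun (congrArg (D.cov2 a) h3) b) m
  rw [cov2_add, Matrix.add_apply, h1, h2] at h4
  have e1 : ∀ p q, D.dddRic a b p q m = D.covComp (fun p q b m => D.ddRic b p q m) a p q b m :=
    fun p q => by simp only [dddRic, cov4_apply, covComp]; ring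
  have e2 : D.dddRic a b m = Matrix.of fun p q =>
      D.covComp (fun p q b m => D.ddRic b m p q) a p q b m := by
    ext p q
    simp only [dddRic, cov4_apply, covComp, Matrix.of_apply]; ring
  rw [e2, ← h4, two_mul]
  simp only [e1]

variable (D)

theorem d_scal (l : Fin 3) : D.d l D.scal = D.contract (D.dRic l) := by
  rw [scal, d_contract, dRic]

/-! ### The curl operator -/

/-- The antisymmetric symbol as a matrix in its outer indices. -/
noncomputable def etaMat (A : Type*) [CommRing A] [Algebra ℝ A] (l : Fin 3) :
    Matrix (Fin 3) (Fin 3) A :=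
  Matrix.of fun k m => algebraMap ℝ A (eta k l m)

/-- The operator `Yₗₘⱼ ↦ gᵢₖ εᵏˡᵐ Yₗₘⱼ`. -/
noncomputable def curl (Y : Fin 3 → Matrix (Fin 3) (Fin 3) A) : Matrix (Fin 3) (Fin 3) A :=
  D.w • ∑ l, D.g * etaMat A l * Y l

theorem etaMat_zero : etaMat A 0 = !![0, 0, 0; 0, 0, -1; 0, 1, 0] := by
  ext k m
  have h : eta k 0 m = (!![0, 0, 0; 0, 0, -1; 0, 1, 0] : Matrix (Fin 3) (Fin 3) ℝ) k m := by
    fin_cases k <;> fin_cases m <;> simp [eta] <;> norm_num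
  rw [etaMat, Matrix.of_apply, h]
  fin_cases k <;> fin_cases m <;> simp

theorem etaMat_one : etaMat A 1 = !![0, 0, 1; 0, 0, 0; -1, 0, 0] := by
  ext k m
  have h : eta k 1 m = (!![0, 0, 1; 0, 0, 0; -1, 0, 0] : Matrix (Fin 3) (Fin 3) ℝ) k m := by
    fin_cases k <;> fin_cases m <;> simp [eta] <;> norm_num
  rw [etaMat, Matrix.of_apply, h]
  fin_cases k <;> fin_cases m <;> simp

theorem etaMat_two : etaMat A 2 = !![0, -1, 0; 1, 0, 0; 0, 0, 0] := by
  ext k m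
  have h : eta k 2 m = (!![0, -1, 0; 1, 0, 0; 0, 0, 0] : Matrix (Fin 3) (Fin 3) ℝ) k m := by
    fin_cases k <;> fin_cases m <;> simp [eta] <;> norm_num
  rw [etaMat, Matrix.of_apply, h]
  fin_cases k <;> fin_cases m <;> simp

/-- The infinitesimal form of the law that a linear map acts on the alternating symbol through its
determinant: a derivation acts through its trace. -/
theorem etaMat_trace (X : Matrix (Fin 3) (Fin 3) A) (l : Fin 3) :
    X * etaMat A l + etaMat A l * Xᵀ
      = (X 0 0 + X 1 1 + X 2 2) • etaMat A l - ∑ p, X l p • etaMat A p := by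
  ext k m
  simp only [Matrix.add_apply, Matrix.sub_apply, Matrix.mul_apply, Matrix.smul_apply,
    Fin.sum_univ_three, Matrix.transpose_apply, smul_eq_mul, etaMat_zero, etaMat_one, etaMat_two]
  fin_cases l <;> fin_cases k <;> fin_cases m <;>
    simp [etaMat_zero, etaMat_one, etaMat_two] <;> ring

theorem mapDer_etaMat (δ : Derivation ℝ A A) (l : Fin 3) : mapDer δ (etaMat A l) = 0 := by
  ext; simp [etaMat]

/-- Differentiate w² det g = 1, using that the logarithmic derivative of det g is twice the trace of
Γ. -/
theorem d_w (k : Fin 3) : D.d k D.w = -D.w * (D.Γ k 0 0 + D.Γ k 1 1 + D.Γ k 2 2) := by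
  have hc : ∀ i j, D.d k (D.g i j) = ∑ p, D.Γ k p i * D.g p j + ∑ p, D.g i p * D.Γ k p j :=
    fun i j => by
      have := congrFun (congrFun (D.compat k) i) j
      simpa only [Matrix.add_apply, Matrix.mul_apply, Matrix.transpose_apply, mapDer_apply]
        using this
  have hdet : D.d k D.g.det = 2 * (D.Γ k 0 0 + D.Γ k 1 1 + D.Γ k 2 2) * D.g.det := by
    simp only [Matrix.det_fin_three, map_add, map_sub, Derivation.leibniz, smul_eq_mul, hc,
      Fin.sum_univ_three]
    ring
  have h := congrArg (D.d k) D.w_sq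
  simp only [Derivation.leibniz, smul_eq_mul, hdet, Derivation.map_one_eq_zero] at h
  apply two_mul_inj
  linear_combination D.w * h - 2 * (D.d k D.w + (D.Γ k 0 0 + D.Γ k 1 1 + D.Γ k 2 2) * D.w) * D.w_sq

/-- This expresses that ε is parallel. The trace of Γ from `d_w` cancels the one from
`etaMat_trace`; the remaining Γ terms become the connection term of `cov3` on the index summed by
`curl`. -/
theorem cov2_curl (q : Fin 3) (Y : Fin 3 → Matrix (Fin 3) (Fin 3) A) :
    D.cov2 q (D.curl Y) = D.curl (D.cov3 Y q) := by
  have h : ∀ l, D.cov2 q (D.g * etaMat A l * Y l) = D.g * etaMat A l * D.cov2 q (Y l)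
      + (D.Γ q 0 0 + D.Γ q 1 1 + D.Γ q 2 2) • (D.g * etaMat A l * Y l)
      - ∑ p, D.Γ q l p • (D.g * etaMat A p * Y l) := fun l => by
    have e : ∑ p, D.Γ q l p • (D.g * etaMat A p * Y l)
        = D.g * (∑ p, D.Γ q l p • etaMat A p) * Y l := by
      simp only [Finset.mul_sum, Finset.sum_mul, Matrix.mul_smul, Matrix.smul_mul]
    have h' := congrArg (fun x => D.g * x * Y l) (etaMat_trace (D.Γ q) l)
    simp only [mul_sub, sub_mul, mul_add, add_mul, Matrix.mul_smul, Matrix.smul_mul] at h'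
    rw [e, add_sub_assoc, ← h', cov2, mapDer_mul, mapDer_mul, mapDer_etaMat, D.compat, cov2]
    noncomm_ring
  simp only [curl, cov2_smul, cov2_sum, h, d_w, cov3, mul_sub, mul_add]
  simp only [Fin.sum_univ_three, mul_add, Matrix.mul_smul]
  module

end MetricData
end CottonYork

namespace CottonYork

open Matrix

namespace MetricData

variable {A : Type*} [CommRing A] [Algebra ℝ A] (D : MetricData A)

/-! ### The evolution equation -/

/-- The Laplacian of a covariant 2-tensor. -/
def lap (X : Matrix (Fin 3) (Fin 3) A) : Matrix (Fin 3) (Fin 3) A :=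
  ∑ p, ∑ q, D.gi p q • D.cov3 (fun m => D.cov2 m X) p q

/-- The inner product of two covariant 2-tensors. -/
def inner (T S : Matrix (Fin 3) (Fin 3) A) : A := (T * D.gi * Sᵀ * D.gi).trace

/-- The 3-tensor `∇ₗ Rₘⱼ - ¼ (∇ₗ R) gₘⱼ`. -/
noncomputable def preCotton (l : Fin 3) : Matrix (Fin 3) (Fin 3) A :=
  D.dRic l - (algebraMap ℝ A (1 / 4) * D.d l D.scal) • D.g

/-- The Cotton-York tensor. -/
noncomputable def cotton : Matrix (Fin 3) (Fin 3) A := D.curl D.preCotton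

/-- The 3-tensor whose curl is the part of the evolution of the Cotton-York tensor which is
quadratic in the Ricci tensor and its derivative. -/
noncomputable def cottonSource (l : Fin 3) : Matrix (Fin 3) (Fin 3) A :=
  (algebraMap ℝ A (1 / 2) * D.d l (D.inner D.ric D.ric)) • D.g
    - (algebraMap ℝ A (1 / 2) * D.scal * D.d l D.scal) • D.g
    - (2 : A) • (D.ricᵀ * D.gi * D.dRic l) + D.d l D.scal • D.ricᵀ

/-- The right-hand side of the evolution equation of the Cotton-York tensor. -/
noncomputable def cottonEvolution : Matrix (Fin 3) (Fin 3) A :=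
  D.lap D.cotton - (5 : A) • (D.ric * D.gi * D.cotton) - (5 : A) • (D.cotton * D.gi * D.ric)
    + (2 * D.inner D.cotton D.ric) • D.g + (4 * D.scal) • D.cotton + D.curl D.cottonSource

/-! ### Linear changes of coordinates -/

/-- An invertible matrix of constants. -/
structure ConstGL where
  E : Matrix (Fin 3) (Fin 3) A
  F : Matrix (Fin 3) (Fin 3) A
  E_mul_F : E * F = 1
  d_E : ∀ k, mapDer (D.d k) E = 0
  d_F : ∀ k, mapDer (D.d k) F = 0
  dt_E : mapDer D.dt E = 0

namespace ConstGL

variable {D} (P : D.ConstGL)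

theorem F_mul_E : P.F * P.E = 1 := mul_eq_one_comm.mp P.E_mul_F

theorem d_E_apply (k i j : Fin 3) : D.d k (P.E i j) = 0 := congrFun (congrFun (P.d_E k) i) j

theorem dt_E_apply (i j : Fin 3) : D.dt (P.E i j) = 0 := congrFun (congrFun P.dt_E i) j

/-- The components of a covariant 2-tensor in the new coordinates. -/
def conj (X : Matrix (Fin 3) (Fin 3) A) : Matrix (Fin 3) (Fin 3) A := P.Eᵀ * X * P.E

/-- The components of a covariant 3-tensor in the new coordinates. -/
def pull (S : Fin 3 → Matrix (Fin 3) (Fin 3) A) (a : Fin 3) : Matrix (Fin 3) (Fin 3) A :=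
  ∑ k, P.E k a • P.conj (S k)

/-- The new partial derivatives. -/
def der (a : Fin 3) : Derivation ℝ A A := ∑ i, P.E i a • D.d i

theorem der_apply (a : Fin 3) (f : A) : P.der a f = ∑ i, P.E i a * D.d i f := by
  simp only [der, Fin.sum_univ_three]; rfl

theorem mapDer_der (a : Fin 3) (X : Matrix (Fin 3) (Fin 3) A) :
    mapDer (P.der a) X = ∑ i, P.E i a • mapDer (D.d i) X := by
  ext; simp [der_apply, Matrix.sum_apply]

theorem mapDer_conj {δ : Derivation ℝ A A} (h : mapDer δ P.E = 0)
    (X : Matrix (Fin 3) (Fin 3) A) : mapDer δ (P.conj X) = P.conj (mapDer δ X) := by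
  simp [conj, mapDer_mul, mapDer_transpose, h]

theorem conj_add (X Y : Matrix (Fin 3) (Fin 3) A) : P.conj (X + Y) = P.conj X + P.conj Y := by
  simp only [conj]; noncomm_ring

theorem conj_sub (X Y : Matrix (Fin 3) (Fin 3) A) : P.conj (X - Y) = P.conj X - P.conj Y := by
  simp only [conj]; noncomm_ring

theorem conj_smul (a : A) (X : Matrix (Fin 3) (Fin 3) A) : P.conj (a • X) = a • P.conj X := by
  simp [conj]

theorem conj_sum (f : Fin 3 → Matrix (Fin 3) (Fin 3) A) :
    P.conj (∑ p, f p) = ∑ p, P.conj (f p) := by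
  simp [conj, Finset.mul_sum, Finset.sum_mul]

theorem conj_transpose (X : Matrix (Fin 3) (Fin 3) A) : P.conj Xᵀ = (P.conj X)ᵀ := by
  simp [conj, mul_assoc]

/-- The connection matrices in the new coordinates. -/
def conn (a : Fin 3) : Matrix (Fin 3) (Fin 3) A := ∑ i, P.E i a • (P.F * D.Γ i * P.E)

theorem conj_mul_conj_F (X Y : Matrix (Fin 3) (Fin 3) A) :
    P.conj X * (P.F * Y) = P.Eᵀ * X * Y := by
  rw [conj, mul_assoc, ← mul_assoc P.E, P.E_mul_F, one_mul]

/-- The metric data in the new coordinates. -/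
def change : MetricData A where
  d := P.der
  dt := D.dt
  d_comm a b f := by
    simp only [der_apply, Fin.sum_univ_three, map_add, Derivation.leibniz, smul_eq_mul,
      d_E_apply, D.d_comm 1 0, D.d_comm 2 0, D.d_comm 2 1]
    ring
  dt_comm a f := by
    simp only [der_apply, Fin.sum_univ_three, map_add, Derivation.leibniz, smul_eq_mul,
      dt_E_apply, D.dt_comm]
    ring
  g := P.conj D.g
  gi := P.F * D.gi * P.Fᵀ
  Γ := P.conn
  -- The determinant of the metric is multiplied by (det E)², and det F = 1 / det E. An
  -- orientation-reversing change flips the sign of `w`, which is why only w² det g = 1 is required.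
  w := D.w * P.F.det
  g_symm := by rw [← conj_transpose, D.g_symm]
  g_mul_gi := by
    rw [mul_assoc, conj_mul_conj_F, mul_assoc, ← mul_assoc D.g, D.g_mul_gi, one_mul,
      ← Matrix.transpose_mul, P.F_mul_E, Matrix.transpose_one]
  Γ_symm a c b := by
    have h : ∀ a c b, P.conn a c b = ∑ i, ∑ q, ∑ p, P.E i a * P.F c p * P.E q b * D.Γ i p q :=
      fun a c b => by
        simp only [conn, Matrix.sum_apply, Matrix.smul_apply, Matrix.mul_apply, smul_eq_mul,
          Finset.mul_sum, Finset.sum_mul]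
        refine Finset.sum_congr rfl fun i _ => Finset.sum_congr rfl fun q _ =>
          Finset.sum_congr rfl fun p _ => by ring
    rw [h, h, Finset.sum_comm]
    refine Finset.sum_congr rfl fun i _ => Finset.sum_congr rfl fun q _ =>
      Finset.sum_congr rfl fun p _ => by rw [D.Γ_symm]; ring
  compat a := by
    simp only [mapDer_der, mapDer_conj P (P.d_E _), D.compat, conn, Finset.mul_sum,
      Finset.sum_mul, Matrix.transpose_sum, ← Finset.sum_add_distrib]
    refine Finset.sum_congr rfl fun i _ => ?_
    rw [Matrix.transpose_smul, Matrix.smul_mul, Matrix.mul_smul, ← smul_add, mul_assoc P.F,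
      conj_mul_conj_F, conj, conj, Matrix.transpose_mul, mul_assoc _ P.Fᵀ,
      ← mul_assoc P.Fᵀ, ← mul_assoc P.Fᵀ, ← Matrix.transpose_mul, P.E_mul_F,
      Matrix.transpose_one, one_mul, Matrix.transpose_mul]
    noncomm_ring
  w_sq := by
    have h : P.E.det * P.F.det = 1 := by rw [← Matrix.det_mul, P.E_mul_F, Matrix.det_one]
    rw [conj, Matrix.det_mul, Matrix.det_mul, Matrix.det_transpose]
    linear_combination (P.E.det * P.F.det) ^ 2 * D.w_sq + (P.E.det * P.F.det + 1) * h

theorem F_transpose_mul_conj (X : Matrix (Fin 3) (Fin 3) A) : P.Fᵀ * P.conj X = X * P.E := by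
  rw [conj, ← mul_assoc, ← mul_assoc, ← Matrix.transpose_mul, P.E_mul_F, Matrix.transpose_one,
    one_mul]

theorem conj_mul_F (X : Matrix (Fin 3) (Fin 3) A) : P.conj X * P.F = P.Eᵀ * X := by
  rw [conj, mul_assoc, P.E_mul_F, mul_one]

/-- As `E` is constant, the connection transforms without an inhomogeneous term. -/
theorem cov2_conj (a : Fin 3) (X : Matrix (Fin 3) (Fin 3) A) :
    P.change.cov2 a (P.conj X) = P.pull (fun i => D.cov2 i X) a := by
  simp only [cov2, change, mapDer_der, mapDer_conj P (P.d_E _), conn, pull, Finset.mul_sum,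
      Finset.sum_mul, Matrix.transpose_sum, ← Finset.sum_sub_distrib]
  refine Finset.sum_congr rfl fun i _ => ?_
  rw [Matrix.transpose_smul, Matrix.smul_mul, Matrix.mul_smul, ← smul_sub, ← smul_sub,
    mul_assoc P.F, ← mul_assoc _ P.F, conj_mul_F, Matrix.transpose_mul, mul_assoc _ P.Fᵀ,
    F_transpose_mul_conj, Matrix.transpose_mul]
  simp only [conj]
  noncomm_ring

theorem E_mul_conn (a : Fin 3) : P.E * P.conn a = ∑ i, P.E i a • (D.Γ i * P.E) := by
  simp only [conn, Finset.mul_sum, Matrix.mul_smul]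
  exact Finset.sum_congr rfl fun i _ => by
    rw [← mul_assoc, ← mul_assoc, P.E_mul_F, one_mul]

theorem cov3_pull (S : Fin 3 → Matrix (Fin 3) (Fin 3) A) (l k : Fin 3) :
    P.change.cov3 (P.pull S) l k = ∑ a, ∑ b, (P.E a l * P.E b k) • P.conj (D.cov3 S a b) := by
  have h1 : P.change.cov2 l (P.pull S k)
      = ∑ a, ∑ b, (P.E a l * P.E b k) • P.conj (D.cov2 a (S b)) := by
    have : ∀ b, P.change.d l (P.E b k) = 0 := fun b => by
      simp [change, der_apply, d_E_apply]
    simp only [pull, cov2_sum, cov2_smul, this, zero_smul, zero_add, cov2_conj, Finset.smul_sum,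
      smul_smul]
    rw [Finset.sum_comm]
    simp only [mul_comm]
  have h2 : ∑ p, P.change.Γ l p k • P.pull S p
      = ∑ a, ∑ b, ∑ p, (P.E a l * P.E b k * D.Γ a p b) • P.conj (S p) := by
    have : ∑ p, P.change.Γ l p k • P.pull S p = ∑ p, (P.E * P.conn l) p k • P.conj (S p) := by
      simp only [pull, Finset.smul_sum, smul_smul, Matrix.mul_apply, Finset.sum_smul]
      rw [Finset.sum_comm]
      simp only [mul_comm (P.E _ _)]
      rfl
    rw [this, E_mul_conn]
    simp only [Matrix.sum_apply, Matrix.smul_apply, Matrix.mul_apply, smul_eq_mul,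
      Finset.mul_sum, Finset.sum_smul]
    rw [Finset.sum_comm]
    refine Finset.sum_congr rfl fun a _ => ?_
    rw [Finset.sum_comm]
    exact Finset.sum_congr rfl fun b _ => Finset.sum_congr rfl fun p _ => by congr 1; ring
  rw [cov3, h1, h2, ← Finset.sum_sub_distrib]
  refine Finset.sum_congr rfl fun a _ => ?_
  rw [← Finset.sum_sub_distrib]
  refine Finset.sum_congr rfl fun b _ => ?_
  rw [cov3, conj_sub, conj_sum, smul_sub, Finset.smul_sum]
  simp only [conj_smul, smul_smul]

theorem rm_change (a b : Fin 3) :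
    P.change.rm a b = ∑ i, ∑ j, (P.E i a * P.E j b) • (P.F * D.rm i j * P.E) := by
  have h1 : ∀ a b, mapDer (P.der a) (P.conn b)
      = ∑ i, ∑ j, (P.E i a * P.E j b) • (P.F * mapDer (D.d i) (D.Γ j) * P.E) := fun a b => by
    simp only [mapDer_der]
    simp only [conn, mapDer_sum, mapDer_smul, d_E_apply, zero_smul, zero_add,
      mapDer_mul, P.d_E, P.d_F, zero_mul, mul_zero, add_zero, Finset.smul_sum, smul_smul]
  have h2 : ∀ a b, P.conn a * P.conn b
      = ∑ i, ∑ j, (P.E i a * P.E j b) • (P.F * (D.Γ i * D.Γ j) * P.E) := fun a b => by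
    simp only [conn, Finset.sum_mul_sum, Matrix.smul_mul, Matrix.mul_smul, smul_smul]
    refine Finset.sum_congr rfl fun i _ => Finset.sum_congr rfl fun j _ => ?_
    rw [mul_comm (P.E _ _)]
    congr 1
    calc P.F * D.Γ i * P.E * (P.F * D.Γ j * P.E)
        = P.F * D.Γ i * (P.E * P.F) * D.Γ j * P.E := by noncomm_ring
      _ = _ := by rw [P.E_mul_F]; noncomm_ring
  have h3 : ∀ X : Fin 3 → Fin 3 → Matrix (Fin 3) (Fin 3) A,
      ∑ i, ∑ j, (P.E i b * P.E j a) • (P.F * X i j * P.E)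
        = ∑ i, ∑ j, (P.E i a * P.E j b) • (P.F * X j i * P.E) := fun X => by
    rw [Finset.sum_comm]
    simp only [mul_comm]
  simp only [rm, change, h1, h2, h3 (fun i j => mapDer (D.d i) (D.Γ j)),
    h3 (fun i j => D.Γ i * D.Γ j), ← Finset.sum_sub_distrib, ← Finset.sum_add_distrib]
  refine Finset.sum_congr rfl fun i _ => Finset.sum_congr rfl fun j _ => ?_
  rw [← smul_sub, ← smul_add, ← smul_sub]
  congr 1
  noncomm_ring

theorem ric_change : P.change.ric = P.conj D.ric := by
  ext b c
  simp only [ric, Matrix.of_apply, rm_change, Matrix.sum_apply, Matrix.smul_apply, smul_eq_mul]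
  have h : ∀ i j, ∑ a, P.E i a * (P.F * D.rm i j * P.E) a c = (D.rm i j * P.E) i c :=
    fun i j => by
      rw [← Matrix.mul_apply, ← mul_assoc, ← mul_assoc, P.E_mul_F, one_mul]
  calc _ = ∑ i, ∑ j, P.E j b * ∑ a, P.E i a * (P.F * D.rm i j * P.E) a c := by
        rw [Finset.sum_comm]
        refine Finset.sum_congr rfl fun i _ => ?_
        rw [Finset.sum_comm]
        refine Finset.sum_congr rfl fun j _ => ?_
        rw [Finset.mul_sum]
        exact Finset.sum_congr rfl fun a _ => by ring
    _ = _ := by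
        have h' : ∀ (X : Matrix (Fin 3) (Fin 3) A), P.conj X b c
            = ∑ j, P.E j b * (X * P.E) j c := fun X => by rw [conj, mul_assoc]; rfl
        rw [h']
        simp only [h]
        rw [Finset.sum_comm]
        refine Finset.sum_congr rfl fun j _ => ?_
        rw [← Finset.mul_sum]
        simp only [Matrix.mul_apply, Matrix.of_apply, Finset.sum_mul]
        rw [Finset.sum_comm]

theorem change_gi_contract (f : Fin 3 → Fin 3 → Matrix (Fin 3) (Fin 3) A) :
    ∑ a, ∑ b, P.change.gi a b • ∑ p, ∑ q, (P.E p a * P.E q b) • f p q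
      = ∑ p, ∑ q, D.gi p q • f p q := by
  have h : ∀ p q, ∑ a, ∑ b, P.change.gi a b * (P.E p a * P.E q b) = D.gi p q := fun p q => by
    have : P.E * P.change.gi * P.Eᵀ = D.gi := by
      calc P.E * (P.F * D.gi * P.Fᵀ) * P.Eᵀ
          = (P.E * P.F) * D.gi * (P.E * P.F)ᵀ := by rw [Matrix.transpose_mul]; noncomm_ring
        _ = _ := by rw [P.E_mul_F]; simp
    rw [← this]
    simp only [Matrix.mul_apply, Matrix.transpose_apply, Finset.sum_mul]
    rw [Finset.sum_comm]
    exact Finset.sum_congr rfl fun b _ => Finset.sum_congr rfl fun a _ => by ring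
  calc _ = ∑ a, ∑ p, ∑ q, ∑ b, (P.change.gi a b * (P.E p a * P.E q b)) • f p q := by
        refine Finset.sum_congr rfl fun a _ => ?_
        simp only [Finset.smul_sum, smul_smul]
        rw [Finset.sum_comm]
        exact Finset.sum_congr rfl fun p _ => Finset.sum_comm
    _ = ∑ p, ∑ q, ∑ a, ∑ b, (P.change.gi a b * (P.E p a * P.E q b)) • f p q := by
        rw [Finset.sum_comm]
        exact Finset.sum_congr rfl fun p _ => Finset.sum_comm
    _ = _ := by simp only [← Finset.sum_smul, h]

theorem lap_conj (X : Matrix (Fin 3) (Fin 3) A) :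
    P.change.lap (P.conj X) = P.conj (D.lap X) := by
  have h : (fun m => P.change.cov2 m (P.conj X)) = P.pull (fun m => D.cov2 m X) :=
    funext fun m => P.cov2_conj m X
  simp only [lap, h, cov3_pull, change_gi_contract, conj_sum, conj_smul]

theorem conj_mul_gi_mul_conj (X Y : Matrix (Fin 3) (Fin 3) A) :
    P.conj X * P.change.gi * P.conj Y = P.conj (X * D.gi * Y) := by
  calc P.conj X * (P.F * D.gi * P.Fᵀ) * P.conj Y
      = (P.conj X * P.F) * D.gi * (P.Fᵀ * P.conj Y) := by noncomm_ring
    _ = _ := by rw [conj_mul_F, F_transpose_mul_conj, conj]; noncomm_ring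

theorem trace_conj_mul_gi (X : Matrix (Fin 3) (Fin 3) A) :
    (P.conj X * P.change.gi).trace = (X * D.gi).trace := by
  calc (P.conj X * (P.F * D.gi * P.Fᵀ)).trace
      = (P.conj X * P.F * (D.gi * P.Fᵀ)).trace := by congr 1; noncomm_ring
    _ = (P.Eᵀ * (X * D.gi * P.Fᵀ)).trace := by rw [conj_mul_F]; congr 1; noncomm_ring
    _ = (X * D.gi * (P.Fᵀ * P.Eᵀ)).trace := by rw [Matrix.trace_mul_comm]; congr 1; noncomm_ring
    _ = _ := by
      rw [← Matrix.transpose_mul, P.E_mul_F, Matrix.transpose_one, mul_one]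

theorem inner_conj (X Y : Matrix (Fin 3) (Fin 3) A) :
    P.change.inner (P.conj X) (P.conj Y) = D.inner X Y := by
  rw [inner, ← conj_transpose, conj_mul_gi_mul_conj, trace_conj_mul_gi, inner]

theorem contract_conj (X : Matrix (Fin 3) (Fin 3) A) :
    P.change.contract (P.conj X) = D.contract X := by
  have h : ∀ (D : MetricData A) X, D.contract X = (X * D.gi).trace := fun D X => by
    simp only [contract, Matrix.trace, Matrix.diag_apply, Matrix.mul_apply]
    exact Finset.sum_congr rfl fun i _ => Finset.sum_congr rfl fun j _ => by
      rw [D.gi_symm_apply]; ring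
  rw [h, h, trace_conj_mul_gi]

theorem scal_change : P.change.scal = D.scal := by
  rw [scal, ric_change, contract_conj, scal]

/-- Acting on all three indices of the alternating symbol multiplies it by the determinant;
`etaMat_trace` is the linearised version. -/
theorem sum_E_etaMat (E : Matrix (Fin 3) (Fin 3) A) (l : Fin 3) :
    ∑ a, E l a • (E * etaMat A a * Eᵀ) = E.det • etaMat A l := by
  ext k m
  simp only [Fin.sum_univ_three, Matrix.add_apply, Matrix.smul_apply, Matrix.mul_apply,
    smul_eq_mul, Matrix.transpose_apply, etaMat_zero, etaMat_one, etaMat_two,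
    Matrix.det_fin_three]
  fin_cases l <;> fin_cases k <;> fin_cases m <;>
    simp [etaMat_zero, etaMat_one, etaMat_two] <;> ring

/-- The det E produced by the alternating symbol cancels the det F in the new `w`, so `curl` is
tensorial, with no orientation condition. -/
theorem curl_pull (Y : Fin 3 → Matrix (Fin 3) (Fin 3) A) :
    P.change.curl (P.pull Y) = P.conj (D.curl Y) := by
  have h : P.F.det * P.E.det = 1 := by rw [← Matrix.det_mul, P.F_mul_E, Matrix.det_one]
  have h2 : ∀ l, P.Eᵀ * D.g * (∑ a, P.E l a • (P.E * etaMat A a * P.Eᵀ)) * Y l * P.E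
      = P.E.det • P.conj (D.g * etaMat A l * Y l) := fun l => by
    rw [sum_E_etaMat, conj, Matrix.mul_smul, Matrix.smul_mul, Matrix.smul_mul]
    congr 1
    noncomm_ring
  have h3 : ∑ a, P.conj D.g * etaMat A a * P.pull Y a
      = P.E.det • P.conj (∑ l, D.g * etaMat A l * Y l) := by
    rw [conj_sum, Finset.smul_sum]
    simp only [pull, Finset.mul_sum, Matrix.mul_smul]
    rw [Finset.sum_comm]
    refine Finset.sum_congr rfl fun l _ => ?_
    rw [← h2]
    simp only [Finset.mul_sum, Finset.sum_mul, Matrix.mul_smul, Matrix.smul_mul]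
    exact Finset.sum_congr rfl fun a _ => by simp only [conj, mul_assoc]
  calc (D.w * P.F.det) • ∑ a, P.conj D.g * etaMat A a * P.pull Y a
      = (D.w * (P.F.det * P.E.det)) • P.conj (∑ l, D.g * etaMat A l * Y l) := by
        rw [h3, smul_smul, mul_assoc]
    _ = _ := by rw [h, mul_one, curl, conj_smul]

theorem dRic_change : P.change.dRic = P.pull D.dRic := by
  funext a
  rw [dRic, ric_change, cov2_conj]; rfl

theorem preCotton_change : P.change.preCotton = P.pull D.preCotton := by
  funext a
  have h : P.change.d a = P.der a := rfl
  have hg : P.change.g = P.conj D.g := rfl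
  simp only [preCotton, dRic_change, scal_change, h, hg, der_apply, pull, conj_sub, conj_smul,
    Fin.sum_univ_three]
  module

theorem cotton_change : P.change.cotton = P.conj D.cotton := by
  rw [cotton, preCotton_change, curl_pull, cotton]

theorem cottonSource_change : P.change.cottonSource = P.pull D.cottonSource := by
  funext a
  have h : P.change.d a = P.der a := rfl
  have hg : P.change.g = P.conj D.g := rfl
  simp only [cottonSource, dRic_change, ric_change, inner_conj, scal_change, h, hg, der_apply,
    ← conj_transpose, conj_mul_gi_mul_conj, ← conj_smul, ← conj_sub, ← conj_add, pull,
    ← conj_sum]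
  congr 1
  simp only [Fin.sum_univ_three, mul_add, Matrix.mul_smul]
  module

theorem cottonEvolution_change : P.change.cottonEvolution = P.conj D.cottonEvolution := by
  have hg : P.change.g = P.conj D.g := rfl
  simp only [cottonEvolution, cottonSource_change, cotton_change, ric_change, inner_conj,
    scal_change, hg, curl_pull, lap_conj, conj_mul_gi_mul_conj, ← conj_smul, ← conj_sub,
    ← conj_add]

theorem flow_change (hD : D.Flow) : P.change.Flow := by
  rw [Flow, ric_change, ← conj_smul, ← hD]
  exact P.mapDer_conj P.dt_E D.g

theorem dt_cotton_change :
    mapDer P.change.dt P.change.cotton = P.conj (mapDer D.dt D.cotton) := by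
  rw [cotton_change]
  exact P.mapDer_conj P.dt_E _

end ConstGL
end MetricData
end CottonYork

namespace CottonYork

open Matrix MetricData

/-! ### The polynomial identity at a point with g = 1. -/

section Pointwise

/-- The antisymmetric matrix with axial vector `v`. -/
def skewMat (v : Fin 3 → ℝ) : Matrix (Fin 3) (Fin 3) ℝ :=
  !![0, v 2, -v 1; -v 2, 0, v 0; v 1, -v 0, 0]

/-- The three-dimensional curvature tensor with sectional part `b`, in an orthonormal basis. -/
def curvOf (b : Matrix (Fin 3) (Fin 3) ℝ) : Fin 3 → Fin 3 → Matrix (Fin 3) (Fin 3) ℝ :=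
  ![![0, skewMat (b 2), -skewMat (b 1)], ![-skewMat (b 2), 0, skewMat (b 0)],
    ![skewMat (b 1), -skewMat (b 0), 0]]

/-- The Ricci tensor of `curvOf b`. -/
def ricOf (b : Matrix (Fin 3) (Fin 3) ℝ) : Matrix (Fin 3) (Fin 3) ℝ :=
  !![b 1 1 + b 2 2, -b 0 1, -b 0 2; -b 0 1, b 0 0 + b 2 2, -b 1 2;
    -b 0 2, -b 1 2, b 0 0 + b 1 1]

variable (r : Matrix (Fin 3) (Fin 3) ℝ) (s : Fin 3 → Matrix (Fin 3) (Fin 3) ℝ)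
  (ρ : Fin 3 → Fin 3 → Matrix (Fin 3) (Fin 3) ℝ)
  (σ : Fin 3 → Fin 3 → Fin 3 → Matrix (Fin 3) (Fin 3) ℝ)

/-- The Kronecker symbol. -/
def kron (i j : Fin 3) : ℝ := if i = j then 1 else 0

/-- The commutator of the outer two derivatives of the Ricci tensor. -/
def commL (a b c i j : Fin 3) : ℝ :=
  -∑ p, ρ a b p i * s c p j - ∑ p, s c i p * ρ a b p j - ∑ p, ρ a b p c * s p i j

/-- The commutator of the inner two derivatives of the Ricci tensor. -/
def commR (a b c i j : Fin 3) : ℝ :=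
  -∑ p, σ a b c p i * r p j - ∑ p, r i p * σ a b c p j
    - ∑ p, ρ b c p i * s a p j - ∑ p, s a i p * ρ b c p j

/-- The commutator of the heat operator with the covariant derivative of the Ricci tensor. -/
noncomputable def heatComm (a j k : Fin 3) : ℝ :=
  ∑ i, (commL s ρ a i i j k + commR r s ρ σ i a i j k - commR r s ρ σ a i j i k
    - commR r s ρ σ a i k i j + (1 / 2) * commR r s ρ σ a j k i i)

/-- The contribution of the evolution of the connection. -/
def connTerm (a j k : Fin 3) : ℝ :=
  -∑ p, (s p a j - s a p j - s j p a) * r p k - ∑ p, r j p * (s p a k - s a p k - s k p a)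

noncomputable def cot (i j : Fin 3) : ℝ :=
  ∑ l, ∑ m, etaMat ℝ l i m * (s l m j - (1 / 4) * (∑ a, s l a a) * kron m j)

noncomputable def src (l m j : Fin 3) : ℝ :=
  (∑ p, ∑ q, r p q * s l p q) * kron m j
    - (1 / 2) * (∑ a, r a a) * (∑ a, s l a a) * kron m j
    - 2 * ∑ p, r p m * s l p j + (∑ a, s l a a) * r j m

/-- The time derivative of `∇ₗ Rₘⱼ`, up to the Laplacian. -/
noncomputable def dtPart (l m j : Fin 3) : ℝ := heatComm r s ρ σ l m j + connTerm r s l m j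

-- The terms left of ∂ₜC = ΔC + … once the Laplacians cancel and `w` is divided out. On the left,
-- the scalar curvature factor comes from ∂ₜw, the term -2 Ric · C from ∂ₜg in the lowered index,
-- and the curl from ∂ₜ(∇Ric - ¼ ∇R ⊗ g). The hypotheses on `b` and `bs` are the linear relations
-- needed: symmetry and vanishing divergence.
set_option maxHeartbeats 1000000 in
theorem evolution_core (b : Matrix (Fin 3) (Fin 3) ℝ) (bs : Fin 3 → Matrix (Fin 3) (Fin 3) ℝ)
    (hb : ∀ i j, b i j = b j i) (hbs : ∀ k i j, bs k i j = bs k j i)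
    (hdiv : ∀ j, bs 0 0 j = -bs 1 1 j - bs 2 2 j)
    (r : Matrix (Fin 3) (Fin 3) ℝ) (s : Fin 3 → Matrix (Fin 3) (Fin 3) ℝ)
    (ρ : Fin 3 → Fin 3 → Matrix (Fin 3) (Fin 3) ℝ)
    (σ : Fin 3 → Fin 3 → Fin 3 → Matrix (Fin 3) (Fin 3) ℝ)
    (hr : r = ricOf b) (hs : s = fun k => ricOf (bs k)) (hρ : ρ = curvOf b)
    (hσ : σ = fun a => curvOf (bs a)) (i j : Fin 3) :
    (∑ a, r a a) * cot s i j - 2 * ∑ k, r i k * cot s k j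
      + ∑ l, ∑ m, etaMat ℝ l i m * (dtPart r s ρ σ l m j
        - (1 / 4) * (2 * (∑ p, ∑ q, r p q * s l p q) + ∑ p, dtPart r s ρ σ l p p)
          * kron m j
        + (1 / 2) * (∑ a, s l a a) * r m j)
    = -(5 * ∑ p, r i p * cot s p j) - 5 * ∑ p, cot s i p * r p j
      + 2 * (∑ p, ∑ q, cot s p q * r p q) * kron i j
      + 4 * (∑ a, r a a) * cot s i j + ∑ l, ∑ m, etaMat ℝ l i m * src r s l m j := by
  subst hr hs hρ hσ
  fin_cases i <;> fin_cases j <;>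
  · beta_reduce
    simp [kron, cot, src, Fin.sum_univ_three, etaMat_zero, etaMat_one, etaMat_two]
    simp only [dtPart, heatComm, connTerm, commL, commR, Fin.sum_univ_three, ricOf, curvOf,
      skewMat, Matrix.of_apply, Matrix.cons_val, Matrix.neg_apply, Matrix.zero_apply]
    -- Eliminating the dependent entries leaves free variables, in which each component is a
    -- polynomial identity.
    simp only [hb 1 0, hb 2 0, hb 2 1, hbs _ 1 0, hbs _ 2 0, hbs _ 2 1, hdiv]
    ring

end Pointwise
end CottonYork

/-! ### Curvature from Ricci in dimension three. -/

namespace CottonYork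

open Matrix

theorem eq_skewMat (X : Matrix (Fin 3) (Fin 3) ℝ) (h : ∀ k l, X k l = -X l k) :
    X = skewMat ![X 1 2, X 2 0, X 0 1] := by
  have d : ∀ k, X k k = 0 := fun k => self_eq_neg.mp (h k k)
  have h1 := h 1 0
  have h2 := h 0 2
  have h3 := h 2 1
  ext k l
  fin_cases k <;> fin_cases l <;> simp [skewMat, d, h1, h2, h3]

/-- A three-dimensional algebraic curvature tensor is determined by its Ricci tensor. -/
theorem exists_curvOf (ρ : Fin 3 → Fin 3 → Matrix (Fin 3) (Fin 3) ℝ)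
    (h1 : ∀ i j, ρ j i = -ρ i j) (h2 : ∀ i j k l, ρ i j k l = -ρ i j l k)
    (r : Matrix (Fin 3) (Fin 3) ℝ) (hr : ∀ j k, r j k = ∑ i, ρ i j i k)
    (hs : ∀ j k, r j k = r k j) :
    ∃ b : Matrix (Fin 3) (Fin 3) ℝ, (∀ i j, b i j = b j i) ∧ ρ = curvOf b ∧ r = ricOf b := by
  have d1 : ∀ i, ρ i i = 0 := fun i => by
    ext k l
    exact self_eq_neg.mp (congrFun (congrFun (h1 i i) k) l)
  obtain ⟨b, hb⟩ : ∃ b : Matrix (Fin 3) (Fin 3) ℝ, ρ = curvOf b := by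
    let ax (X : Matrix (Fin 3) (Fin 3) ℝ) : Fin 3 → ℝ := ![X 1 2, X 2 0, X 0 1]
    refine ⟨![ax (ρ 1 2), ax (ρ 2 0), ax (ρ 0 1)], ?_⟩
    have e := fun i j => eq_skewMat (ρ i j) (h2 i j)
    have e12 := e 1 2
    have e20 := e 2 0
    have e01 := e 0 1
    have e21 := (h1 1 2).trans (congrArg Neg.neg e12)
    have e02 := (h1 2 0).trans (congrArg Neg.neg e20)
    have e10 := (h1 0 1).trans (congrArg Neg.neg e01)
    funext i j
    fin_cases i <;> fin_cases j
    exacts [d1 0, e01, e02, e10, d1 1, e12, e20, e21, d1 2]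
  -- Off the diagonal Ric is -bᵀ, so symmetry of Ric is symmetry of `b`; no pair symmetry of the
  -- curvature has to be assumed.
  have hr' : ∀ j k, r j k = !![b 1 1 + b 2 2, -b 1 0, -b 2 0; -b 0 1, b 0 0 + b 2 2, -b 2 1;
      -b 0 2, -b 1 2, b 0 0 + b 1 1] j k := fun j k => by
    rw [hr, hb, Fin.sum_univ_three]
    fin_cases j <;> fin_cases k <;>
      simp only [Fin.zero_eta, Fin.mk_one, Fin.reduceFinMk, curvOf, skewMat, Matrix.of_apply,
        Matrix.cons_val, Matrix.neg_apply, Matrix.zero_apply] <;> ring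
  have e1 := hs 0 1
  have e2 := hs 0 2
  have e3 := hs 1 2
  simp only [hr', Matrix.of_apply, Matrix.cons_val, neg_inj] at e1 e2 e3
  refine ⟨b, ?_, hb, ?_⟩
  · intro i j
    fin_cases i <;> fin_cases j <;> simp [e1, e2, e3]
  · ext j k
    rw [hr', ricOf, e1, e2, e3]

end CottonYork

namespace CottonYork

open Matrix

namespace MetricData

variable {A : Type*} [CommRing A] [Algebra ℝ A] {D : MetricData A} (χ : A →ₐ[ℝ] ℝ)

/-! ### Evaluation at a point where the metric is the identity matrix -/

theorem map_mul_algHom (X Y : Matrix (Fin 3) (Fin 3) A) :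
    (X * Y).map χ = X.map χ * Y.map χ :=
  Matrix.map_mul

theorem map_gi (hg : D.g.map χ = 1) : D.gi.map χ = 1 := by
  have h := congrArg (fun X : Matrix (Fin 3) (Fin 3) A => X.map χ) D.g_mul_gi
  simp only [map_mul_algHom, hg, one_mul] at h
  rw [h]
  exact Matrix.map_one _ (map_zero χ) (map_one χ)

theorem map_g_apply (hg : D.g.map χ = 1) (i j : Fin 3) : χ (D.g i j) = kron i j := by
  have := congrFun (congrFun hg i) j
  rwa [Matrix.one_apply] at this

theorem map_gi_apply (hg : D.g.map χ = 1) (i j : Fin 3) : χ (D.gi i j) = kron i j := by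
  have := congrFun (congrFun (map_gi χ hg) i) j
  rwa [Matrix.one_apply] at this

theorem map_contract (hg : D.g.map χ = 1) (X : Matrix (Fin 3) (Fin 3) A) :
    χ (D.contract X) = ∑ p, χ (X p p) := by
  simp [contract, map_gi_apply χ hg, kron]

theorem map_rm_antisymm (hg : D.g.map χ = 1) (i j k l : Fin 3) :
    χ (D.rm i j k l) = -χ (D.rm i j l k) := by
  have h := congrArg (fun X : Matrix (Fin 3) (Fin 3) A => X.map χ) (D.g_mul_rm i j)
  simp only [map_mul_algHom, hg, mul_one] at h
  have h2 := congrFun (congrFun h l) k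
  simpa [Matrix.mul_apply, map_g_apply χ hg, kron] using h2

theorem map_covRm_antisymm (hg : D.g.map χ = 1) (a i j k l : Fin 3) :
    χ (D.covRm a i j k l) = -χ (D.covRm a i j l k) := by
  have h := congrArg (fun X : Matrix (Fin 3) (Fin 3) A => X.map χ) (D.g_mul_covRm a i j)
  simp only [map_mul_algHom, hg, mul_one] at h
  have h2 := congrFun (congrFun h l) k
  simpa [Matrix.mul_apply, map_g_apply χ hg, kron] using h2

variable (D) in
/-- The value of the Ricci tensor. -/
def ptRic : Matrix (Fin 3) (Fin 3) ℝ := D.ric.map χ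

variable (D) in
/-- The value of the covariant derivative of the Ricci tensor. -/
def ptdRic (k : Fin 3) : Matrix (Fin 3) (Fin 3) ℝ := (D.dRic k).map χ

variable (D) in
/-- The value of the curvature tensor. -/
def ptRm (i j : Fin 3) : Matrix (Fin 3) (Fin 3) ℝ := (D.rm i j).map χ

variable (D) in
/-- The value of the covariant derivative of the curvature tensor. -/
def ptdRm (a i j : Fin 3) : Matrix (Fin 3) (Fin 3) ℝ := (D.covRm a i j).map χ

variable (D) in
/-- The value of the Laplacian of the covariant derivative of the Ricci tensor. -/
def ptLap (l m j : Fin 3) : ℝ := ∑ i, χ (D.dddRic i i l m j)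

theorem map_dddRic_left (a b c i j : Fin 3) :
    χ (D.dddRic a b c i j) - χ (D.dddRic b a c i j) = commL (D.ptdRic χ) (D.ptRm χ) a b c i j := by
  have h := congrFun (congrFun (D.dddRic_comm_left a b c) i) j
  rw [Matrix.sub_apply] at h
  rw [← map_sub, h]
  simp [Matrix.mul_apply, Matrix.sum_apply, commL, ptdRic, ptRm]

theorem map_dddRic_right (a b c i j : Fin 3) :
    χ (D.dddRic a b c i j) - χ (D.dddRic a c b i j)
      = commR (D.ptRic χ) (D.ptdRic χ) (D.ptRm χ) (D.ptdRm χ) a b c i j := by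
  have h := congrFun (congrFun (D.dddRic_comm_right a b c) i) j
  rw [Matrix.sub_apply] at h
  rw [← map_sub, h]
  simp [Matrix.mul_apply, commR, ptRic, ptdRic, ptRm, ptdRm]

/-- Of the six third-derivative terms, two cancel in the trace, one becomes Δ∇Ric after two
commutations, and two become divergences of Ric after one commutation each. -/
theorem Flow.map_cov2_dt_ric (hD : D.Flow) (hg : D.g.map χ = 1) (a j k : Fin 3) :
    χ (D.cov2 a (mapDer D.dt D.ric) j k) = D.ptLap χ a j k
      + heatComm (D.ptRic χ) (D.ptdRic χ) (D.ptRm χ) (D.ptdRm χ) a j k := by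
  have hb : ∀ b m, 2 * ∑ p, χ (D.dddRic a b p p m) = ∑ p, χ (D.dddRic a b m p p) := fun b m => by
    have := congrArg χ (hD.contract_dddRic a b m)
    rw [map_mul, map_contract χ hg, map_contract χ hg] at this
    rwa [map_ofNat χ 2] at this
  rw [hD.cov2_dt_ric, map_contract χ hg]
  simp only [heatComm, ← map_dddRic_left, ← map_dddRic_right, ptLap, Matrix.of_apply, map_sub,
    map_add, Fin.sum_univ_three]
  have h1 := hb j k
  have h2 := hb k j
  simp only [Fin.sum_univ_three] at h1 h2
  -- The divergences turn into -½ ∇ₐ∇ⱼ∇ₖR - ½ ∇ₐ∇ₖ∇ⱼR; with the sixth term +∇ₐ∇ⱼ∇ₖR this is the last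
  -- commutator of `heatComm`, with its factor ½.
  linear_combination -h1 / 2 - h2 / 2

theorem Flow.map_dt_dRic (hD : D.Flow) (hg : D.g.map χ = 1) (a j k : Fin 3) :
    χ (D.dt (D.dRic a j k)) = D.ptLap χ a j k
      + dtPart (D.ptRic χ) (D.ptdRic χ) (D.ptRm χ) (D.ptdRm χ) a j k := by
  have h := congrFun (congrFun (hD.dt_dRic a) j) k
  rw [mapDer_apply] at h
  rw [h, dtPart, ← add_assoc, ← hD.map_cov2_dt_ric χ hg]
  simp only [Matrix.sub_apply, map_sub, Matrix.mul_apply, Matrix.transpose_apply, map_sum,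
    map_mul, map_gi_apply χ hg, kron, dtΓLow, Matrix.of_apply, connTerm, ptRic, ptdRic,
    Matrix.map_apply]
  simp
  ring

theorem map_d_scal (hg : D.g.map χ = 1) (l : Fin 3) :
    χ (D.d l D.scal) = ∑ a, D.ptdRic χ l a a := by
  rw [d_scal, map_contract χ hg]; rfl

theorem map_scal (hg : D.g.map χ = 1) : χ D.scal = ∑ a, D.ptRic χ a a := by
  rw [scal, map_contract χ hg]; rfl

theorem Flow.dt_g_apply (hD : D.Flow) (i j : Fin 3) : D.dt (D.g i j) = -2 * D.ric i j :=
  congrFun (congrFun hD i) j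

theorem Flow.map_dt_gi (hD : D.Flow) (hg : D.g.map χ = 1) (i j : Fin 3) :
    χ (D.dt (D.gi i j)) = 2 * D.ptRic χ i j := by
  have h := congrFun (congrFun (D.mapDer_gi D.dt) i) j
  rw [mapDer_apply] at h
  rw [h, hD]
  simp [Matrix.mul_apply, map_gi_apply χ hg, kron, ptRic, show χ 2 = 2 from map_ofNat χ 2]

theorem Flow.map_dt_d_scal (hD : D.Flow) (hg : D.g.map χ = 1) (l : Fin 3) :
    χ (D.dt (D.d l D.scal)) = 2 * (∑ p, ∑ q, D.ptRic χ p q * D.ptdRic χ l p q)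
      + ∑ p, χ (D.dt (D.dRic l p p)) := by
  rw [d_scal, contract]
  simp only [map_sum, Derivation.leibniz, map_add, smul_eq_mul, map_mul, hD.map_dt_gi χ hg,
    map_gi_apply χ hg, kron, Finset.sum_add_distrib, Finset.mul_sum, ptdRic, Matrix.map_apply]
  rw [add_comm]
  congr 1
  · exact Finset.sum_congr rfl fun p _ => Finset.sum_congr rfl fun q _ => by ring
  · simp

/-- Differentiate w² det g = 1 in time; at the identity metric det g has derivative -2R, and w² = 1.
-/
theorem Flow.map_dt_w (hD : D.Flow) (hg : D.g.map χ = 1) :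
    χ (D.dt D.w) = χ D.w * ∑ a, D.ptRic χ a a := by
  have h := congrArg (fun x => χ (D.dt x)) D.w_sq
  have h2 := congrArg χ D.w_sq
  simp only [Matrix.det_fin_three, map_add, map_sub, Derivation.leibniz, smul_eq_mul, map_mul,
    hD.dt_g_apply, map_neg, map_ofNat, map_g_apply χ hg, kron, Derivation.map_one_eq_zero,
    map_zero, map_one] at h h2
  simp at h h2
  simp only [ptRic, Matrix.map_apply, Fin.sum_univ_three]
  linear_combination χ D.w / 2 * h
    - (χ (D.dt D.w) - χ D.w * (χ (D.ric 0 0) + χ (D.ric 1 1) + χ (D.ric 2 2))) * h2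

/-- Grouped so that the Laplacian part matches `map_lap_cotton` and the rest matches the left side
of `evolution_core`. -/
theorem Flow.map_dt_preCotton (hD : D.Flow) (hg : D.g.map χ = 1) (l m j : Fin 3) :
    χ (D.dt (D.preCotton l m j)) = D.ptLap χ l m j
      - (1 / 4) * (∑ p, D.ptLap χ l p p) * kron m j
      + (dtPart (D.ptRic χ) (D.ptdRic χ) (D.ptRm χ) (D.ptdRm χ) l m j
        - (1 / 4) * (2 * (∑ p, ∑ q, D.ptRic χ p q * D.ptdRic χ l p q)
          + ∑ p, dtPart (D.ptRic χ) (D.ptdRic χ) (D.ptRm χ) (D.ptdRm χ) l p p) * kron m j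
        + (1 / 2) * (∑ a, D.ptdRic χ l a a) * D.ptRic χ m j) := by
  simp only [preCotton, Matrix.sub_apply, Matrix.smul_apply, smul_eq_mul, map_sub, map_add,
    Derivation.leibniz, Derivation.map_algebraMap, map_mul, hD.dt_g_apply, map_g_apply χ hg,
    hD.map_dt_d_scal χ hg, hD.map_dt_dRic χ hg, map_d_scal χ hg, Finset.sum_add_distrib,
    AlgHom.commutes, Algebra.algebraMap_self, RingHom.id_apply, map_neg, map_ofNat, map_zero]
  simp only [ptRic, Matrix.map_apply]
  ring

theorem map_preCotton (hg : D.g.map χ = 1) (l m j : Fin 3) :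
    χ (D.preCotton l m j) = D.ptdRic χ l m j - (1 / 4) * (∑ a, D.ptdRic χ l a a) * kron m j := by
  simp only [preCotton, Matrix.sub_apply, Matrix.smul_apply, smul_eq_mul, map_sub,
    map_mul, map_g_apply χ hg, map_d_scal χ hg,
    AlgHom.commutes, Algebra.algebraMap_self, RingHom.id_apply]
  rfl

theorem map_etaMat (l i m : Fin 3) : χ (etaMat A l i m) = etaMat ℝ l i m := by
  simp [etaMat]

theorem map_curl (hg : D.g.map χ = 1) (Y : Fin 3 → Matrix (Fin 3) (Fin 3) A) (i j : Fin 3) :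
    χ (D.curl Y i j) = χ D.w * ∑ l, ∑ m, etaMat ℝ l i m * χ (Y l m j) := by
  simp [curl, Matrix.sum_apply, mul_assoc D.g, Matrix.mul_apply (M := D.g), map_g_apply χ hg, kron,
    Matrix.mul_apply (M := etaMat A _), map_etaMat]

theorem Flow.map_dt_curl (hD : D.Flow) (hg : D.g.map χ = 1)
    (Y : Fin 3 → Matrix (Fin 3) (Fin 3) A) (i j : Fin 3) :
    χ (D.dt (D.curl Y i j)) = χ D.w *
      ((∑ a, D.ptRic χ a a) * (∑ l, ∑ m, etaMat ℝ l i m * χ (Y l m j))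
        - 2 * (∑ k, D.ptRic χ i k * ∑ l, ∑ m, etaMat ℝ l k m * χ (Y l m j))
        + ∑ l, ∑ m, etaMat ℝ l i m * χ (D.dt (Y l m j))) := by
  have h : mapDer D.dt (D.curl Y) = D.dt D.w • (∑ l, D.g * etaMat A l * Y l)
      + D.w • ((-2 : A) • (D.ric * ∑ l, etaMat A l * Y l)
      + ∑ l, D.g * etaMat A l * mapDer D.dt (Y l)) := by
    simp only [curl, mapDer_smul, mapDer_sum, mapDer_mul, mapDer_etaMat, zero_add,
      Finset.sum_add_distrib, Finset.mul_sum, Finset.smul_sum, mul_assoc, smul_add,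
      show mapDer D.dt D.g = (-2 : A) • D.ric from hD, Matrix.smul_mul, zero_mul]
  have h2 := congrFun (congrFun h i) j
  rw [mapDer_apply] at h2
  rw [h2]
  simp only [Matrix.add_apply, Matrix.smul_apply, smul_eq_mul, map_add, map_mul,
    Matrix.sum_apply, map_sum, mul_assoc D.g, Matrix.mul_apply (M := D.g), map_g_apply χ hg, kron,
    Matrix.mul_apply (M := etaMat A _), map_etaMat, Matrix.mul_apply (M := D.ric),
    hD.map_dt_w χ hg, mapDer_apply, map_neg, map_ofNat, ptRic, Matrix.map_apply]
  simp only [ite_mul, one_mul, zero_mul, Finset.sum_ite_eq, Finset.mem_univ, if_true]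
  ring

/-! ### The Laplacian of the Cotton-York tensor -/

theorem curl_sub (Y Z : Fin 3 → Matrix (Fin 3) (Fin 3) A) :
    D.curl (fun l => Y l - Z l) = D.curl Y - D.curl Z := by
  simp only [curl, mul_sub, Finset.sum_sub_distrib, smul_sub]

theorem curl_sum_smul (c : Fin 3 → A) (Y : Fin 3 → Fin 3 → Matrix (Fin 3) (Fin 3) A) :
    D.curl (fun l => ∑ p, c p • Y p l) = ∑ p, c p • D.curl (Y p) := by
  simp only [curl, Finset.mul_sum, Matrix.mul_smul, Finset.smul_sum]
  rw [Finset.sum_comm]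
  exact Finset.sum_congr rfl fun p _ => Finset.sum_congr rfl fun l _ => smul_comm _ _ _

/-- Two applications of `cov2_curl`; the connection term on the outer derivative index passes
through `curl` by linearity. -/
theorem lap_curl (Y : Fin 3 → Matrix (Fin 3) (Fin 3) A) :
    D.lap (D.curl Y) = D.curl (fun l => ∑ p, ∑ q, D.gi p q • D.cov4 (D.cov3 Y) p q l) := by
  have h : ∀ p q, D.cov3 (fun m => D.cov2 m (D.curl Y)) p q
      = D.curl (fun l => D.cov4 (D.cov3 Y) p q l) := fun p q => by
    have e : (fun l => D.cov4 (D.cov3 Y) p q l)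
        = fun l => D.cov3 (D.cov3 Y q) p l - ∑ r, D.Γ p r q • D.cov3 Y r l := by
      funext l
      simp only [cov4, cov3]
      abel
    rw [e, curl_sub, curl_sum_smul, ← cov2_curl]
    simp only [cov3, cov2_curl]
  have e : ∀ p, D.curl (fun l => ∑ q, D.gi p q • D.cov4 (D.cov3 Y) p q l)
      = ∑ q, D.gi p q • D.curl (fun l => D.cov4 (D.cov3 Y) p q l) := fun p =>
    curl_sum_smul _ _
  -- Unit coefficients turn the weighted linearity lemma into additivity over the outer sum.
  have e2 := curl_sum_smul (D := D) (fun _ => 1)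
    (fun p l => ∑ q, D.gi p q • D.cov4 (D.cov3 Y) p q l)
  simp only [one_smul] at e2
  rw [e2]
  simp only [lap, h, e]

theorem contract_sub (X Y : Matrix (Fin 3) (Fin 3) A) :
    D.contract (X - Y) = D.contract X - D.contract Y := by
  simp [contract, mul_sub]

theorem contract_sum_smul (c : Fin 3 → A) (Y : Fin 3 → Matrix (Fin 3) (Fin 3) A) :
    D.contract (∑ p, c p • Y p) = ∑ p, c p * D.contract (Y p) := by
  simp only [contract, Fin.sum_univ_three, Matrix.add_apply, Matrix.smul_apply, smul_eq_mul]
  ring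

theorem cov2_contract_smul_g (a : Fin 3) (c : ℝ) (X : Matrix (Fin 3) (Fin 3) A) :
    D.cov2 a ((algebraMap ℝ A c * D.contract X) • D.g)
      = (algebraMap ℝ A c * D.contract (D.cov2 a X)) • D.g := by
  rw [cov2_smul, cov2_g, smul_zero, add_zero, Derivation.leibniz, d_contract,
    Derivation.map_algebraMap, smul_zero, add_zero, smul_eq_mul]

theorem cov3_contract_smul_g (c : ℝ) (S : Fin 3 → Matrix (Fin 3) (Fin 3) A) (a l : Fin 3) :
    D.cov3 (fun l => (algebraMap ℝ A c * D.contract (S l)) • D.g) a l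
      = (algebraMap ℝ A c * D.contract (D.cov3 S a l)) • D.g := by
  simp only [cov3, cov2_contract_smul_g, contract_sub, contract_sum_smul]
  simp only [Fin.sum_univ_three]
  module

theorem cov4_contract_smul_g (c : ℝ) (X : Fin 3 → Fin 3 → Matrix (Fin 3) (Fin 3) A)
    (a b l : Fin 3) :
    D.cov4 (fun b l => (algebraMap ℝ A c * D.contract (X b l)) • D.g) a b l
      = (algebraMap ℝ A c * D.contract (D.cov4 X a b l)) • D.g := by
  simp only [cov4, cov2_contract_smul_g, contract_sub, contract_sum_smul]
  simp only [Fin.sum_univ_three]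
  module

theorem cov3_sub (S T : Fin 3 → Matrix (Fin 3) (Fin 3) A) (a l : Fin 3) :
    D.cov3 (fun l => S l - T l) a l = D.cov3 S a l - D.cov3 T a l := by
  simp only [cov3, cov2_sub, smul_sub, Finset.sum_sub_distrib]; abel

/-- Since g is parallel and ∇R is the trace of ∇Ric, both derivatives pass inside the trace and no
separate calculus for R is needed. -/
theorem cov4_cov3_preCotton (p q l : Fin 3) :
    D.cov4 (D.cov3 D.preCotton) p q l = D.dddRic p q l
      - (algebraMap ℝ A (1 / 4) * D.contract (D.dddRic p q l)) • D.g := by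
  have h : D.cov3 D.preCotton = fun b l => D.ddRic b l
      - (algebraMap ℝ A (1 / 4) * D.contract (D.ddRic b l)) • D.g := by
    funext b l
    have : D.preCotton = fun l => D.dRic l
        - (algebraMap ℝ A (1 / 4) * D.contract (D.dRic l)) • D.g := by
      funext l; rw [preCotton, d_scal]
    rw [this, cov3_sub, cov3_contract_smul_g]; rfl
  rw [h, cov4_sub, cov4_contract_smul_g]; rfl

theorem map_lap_cotton (hg : D.g.map χ = 1) (i j : Fin 3) :
    χ (D.lap D.cotton i j) = χ D.w * ∑ l, ∑ m, etaMat ℝ l i m *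
      (D.ptLap χ l m j - (1 / 4) * (∑ p, D.ptLap χ l p p) * kron m j) := by
  have h : ∀ l m, χ ((∑ p, ∑ q, D.gi p q • D.cov4 (D.cov3 D.preCotton) p q l) m j)
      = D.ptLap χ l m j - (1 / 4) * (∑ p, D.ptLap χ l p p) * kron m j := fun l m => by
    have e : ∀ p q, χ (D.cov4 (D.cov3 D.preCotton) p q l m j)
        = χ (D.dddRic p q l m j) - (1 / 4) * (∑ a, χ (D.dddRic p q l a a)) * kron m j :=
      fun p q => by
        rw [cov4_cov3_preCotton, Matrix.sub_apply, Matrix.smul_apply, smul_eq_mul, map_sub,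
          map_mul, map_mul, map_g_apply χ hg, map_contract χ hg, AlgHom.commutes]
        rfl
    simp only [Matrix.sum_apply, Matrix.smul_apply, smul_eq_mul, map_sum, map_mul, e,
      map_gi_apply χ hg, ptLap]
    simp only [kron, ite_mul, one_mul, zero_mul, Finset.sum_ite_eq, Finset.mem_univ, if_true,
      Finset.sum_sub_distrib]
    rw [Finset.sum_comm (f := fun p i => χ (D.dddRic i i l p p)), ← Finset.sum_mul,
      ← Finset.mul_sum]
  rw [cotton, lap_curl, map_curl χ hg]
  simp only [h]

/-! ### The evolution equation at a point where the metric is the identity matrix -/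

theorem map_inner (hg : D.g.map χ = 1) (X Y : Matrix (Fin 3) (Fin 3) A) :
    χ (D.inner X Y) = ∑ p, ∑ q, χ (X p q) * χ (Y p q) := by
  simp [inner, Matrix.trace, Matrix.mul_apply, map_gi_apply χ hg, kron]

theorem inner_eq_contract (X Y : Matrix (Fin 3) (Fin 3) A) :
    D.inner X Y = D.contract (X * D.gi * Yᵀ) := by
  simp only [inner, contract, Matrix.trace, Matrix.diag_apply, Matrix.mul_apply (N := D.gi)]
  exact Finset.sum_congr rfl fun i _ => Finset.sum_congr rfl fun j _ => by
    rw [D.gi_symm_apply]; ring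

theorem inner_comm (X Y : Matrix (Fin 3) (Fin 3) A) : D.inner X Y = D.inner Y X := by
  rw [inner, ← Matrix.trace_transpose, Matrix.transpose_mul, Matrix.transpose_mul,
    Matrix.transpose_mul, D.gi_symm, Matrix.transpose_transpose, Matrix.trace_mul_comm, inner]
  simp only [mul_assoc]

theorem contract_add (X Y : Matrix (Fin 3) (Fin 3) A) :
    D.contract (X + Y) = D.contract X + D.contract Y := by
  simp [contract, mul_add, Finset.sum_add_distrib]

theorem d_inner_self (l : Fin 3) (X : Matrix (Fin 3) (Fin 3) A) :
    D.d l (D.inner X X) = 2 * D.inner X (D.cov2 l X) := by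
  rw [inner_eq_contract, d_contract, cov2_mul_gi_mul, cov2_transpose, contract_add,
    ← inner_eq_contract, ← inner_eq_contract, inner_comm, two_mul]

theorem map_cottonSource (hg : D.g.map χ = 1) (l m j : Fin 3) :
    χ (D.cottonSource l m j) = src (D.ptRic χ) (D.ptdRic χ) l m j := by
  simp only [cottonSource, d_inner_self, Matrix.add_apply, Matrix.sub_apply, Matrix.smul_apply,
    smul_eq_mul, map_add, map_sub, map_mul, map_g_apply χ hg, map_d_scal χ hg, map_scal χ hg,
    map_inner χ hg, AlgHom.commutes, Algebra.algebraMap_self, RingHom.id_apply, map_ofNat,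
    Matrix.mul_apply, map_sum, map_gi_apply χ hg, Matrix.transpose_apply, src]
  simp [kron, ptRic, ptdRic, dRic]

theorem map_cotton (hg : D.g.map χ = 1) (i j : Fin 3) :
    χ (D.cotton i j) = χ D.w * cot (D.ptdRic χ) i j := by
  rw [cotton, map_curl χ hg]
  simp only [map_preCotton χ hg]
  rfl

theorem Flow.map_dt_cotton (hD : D.Flow) (hg : D.g.map χ = 1) (i j : Fin 3) :
    χ (D.dt (D.cotton i j)) = χ (D.cottonEvolution i j) := by
  have hrs : ∀ j k, D.ptRic χ j k = D.ptRic χ k j := fun j k => by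
    have := congrFun (congrFun hD.ric_symm k) j
    exact congrArg χ this
  obtain ⟨b, hb, hρ, hr⟩ := exists_curvOf (D.ptRm χ)
    (fun i j => by ext k l; simp [ptRm, D.rm_swap i j]) (fun i j k l => map_rm_antisymm χ hg i j k l)
    (D.ptRic χ) (fun j k => by simp [ptRic, ric, ptRm]) hrs
  have hS : ∀ a, ∃ b : Matrix (Fin 3) (Fin 3) ℝ, (∀ i j, b i j = b j i) ∧
      D.ptdRm χ a = curvOf b ∧ D.ptdRic χ a = ricOf b := fun a =>
    exists_curvOf (D.ptdRm χ a) (fun i j => by ext k l; simp [ptdRm, D.covRm_swap a i j])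
      (fun i j k l => map_covRm_antisymm χ hg a i j k l)
      (D.ptdRic χ a) (fun j k => by simp [ptdRic, dRic_apply, ptdRm])
      (fun j k => congrArg χ (hD.dRic_symm a j k))
  choose bs hbs hσ hs using hS
  -- With Ric = (tr b) g - b and R = 2 tr b, the identity 2 div Ric = ∇R reduces to div b = 0.
  have hdiv : ∀ j, bs 0 0 j = -bs 1 1 j - bs 2 2 j := fun j => by
    have h := congrArg χ (hD.contract_dRic j)
    rw [map_mul, map_contract χ hg, map_contract χ hg, map_ofNat χ 2] at h
    have e : ∀ a k l, χ (D.dRic a k l) = ricOf (bs a) k l := fun a k l => by rw [← hs a]; rfl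
    simp only [Matrix.of_apply, e, Fin.sum_univ_three] at h
    have e1 := fun a => hbs a 1 0
    have e2 := fun a => hbs a 2 0
    have e3 := fun a => hbs a 2 1
    fin_cases j <;>
      simp only [Fin.zero_eta, Fin.mk_one, Fin.reduceFinMk, ricOf, Matrix.of_apply,
        Matrix.cons_val, e1, e2, e3] at h ⊢ <;> linarith
  have core := evolution_core b bs hb hbs hdiv (D.ptRic χ) (D.ptdRic χ) (D.ptRm χ) (D.ptdRm χ)
    hr (funext hs) hρ (funext hσ) i j
  have hL : ∀ k, ∑ l, ∑ m, etaMat ℝ l k m * χ (D.preCotton l m j) = cot (D.ptdRic χ) k j :=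
    fun k => by simp only [map_preCotton χ hg]; rfl
  have hR : ∀ p q, χ (D.ric p q) = D.ptRic χ p q := fun _ _ => rfl
  rw [cotton, hD.map_dt_curl χ hg]
  simp only [hL, hD.map_dt_preCotton χ hg]
  simp only [cottonEvolution, Matrix.add_apply, Matrix.sub_apply, Matrix.smul_apply, smul_eq_mul,
    map_add, map_sub, map_mul, map_lap_cotton χ hg, map_curl χ hg (Y := D.cottonSource),
    map_cottonSource χ hg, map_inner χ hg, map_cotton χ hg, map_g_apply χ hg, map_scal χ hg,
    Matrix.mul_apply, map_sum, map_gi_apply χ hg, map_ofNat, hR]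
  simp only [mul_add (etaMat ℝ _ _ _) (_ - _) (_ + _), Finset.sum_add_distrib]
  have e1 : ∀ f : Fin 3 → ℝ, ∀ p, ∑ q, f q * kron q p = f p := fun f p => by simp [kron]
  simp only [e1]
  simp only [mul_left_comm _ (χ D.w), mul_assoc (χ D.w), ← Finset.mul_sum]
  -- Every term carries exactly one factor `w`, and the Laplacian terms agree on both sides.
  linear_combination χ D.w * core

end MetricData
end CottonYork

/-! ### From the identity metric to an arbitrary one. -/

namespace CottonYork

open Matrix

namespace MetricData

variable {A : Type*} [CommRing A] [Algebra ℝ A] {D : MetricData A} (χ : A →ₐ[ℝ] ℝ)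

variable (D) in
/-- An invertible real matrix as a matrix of constants. -/
def constGL (E F : Matrix (Fin 3) (Fin 3) ℝ) (h : E * F = 1) : D.ConstGL where
  E := E.map (algebraMap ℝ A)
  F := F.map (algebraMap ℝ A)
  E_mul_F := by
    rw [← Matrix.map_mul, h]
    exact Matrix.map_one _ (map_zero _) (map_one _)
  d_E k := by ext; simp
  d_F k := by ext; simp
  dt_E := by ext; simp

-- Factor G = BᵀB and take `E = B⁻¹`, `F = B`.
open scoped MatrixOrder in
theorem _root_.Matrix.PosDef.exists_congr_one {G : Matrix (Fin 3) (Fin 3) ℝ} (hG : G.PosDef) :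
    ∃ E F : Matrix (Fin 3) (Fin 3) ℝ, E * F = 1 ∧ Eᵀ * G * E = 1 := by
  obtain ⟨B, hB⟩ := CStarAlgebra.nonneg_iff_eq_star_mul_self.mp hG.posSemidef.nonneg
  rw [Matrix.star_eq_conjTranspose, Matrix.conjTranspose_eq_transpose_of_trivial] at hB
  have hu : IsUnit B.det := by
    have := hG.det_pos
    rw [hB, Matrix.det_mul] at this
    exact isUnit_iff_ne_zero.mpr (right_ne_zero_of_mul this.ne')
  refine ⟨B⁻¹, B, Matrix.nonsing_inv_mul _ hu, ?_⟩
  rw [hB, mul_assoc, mul_assoc, Matrix.mul_nonsing_inv _ hu, mul_one, ← Matrix.transpose_mul,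
    Matrix.mul_nonsing_inv _ hu, Matrix.transpose_one]

/-- The evolution equation of the Cotton-York tensor under Ricci flow. -/
theorem Flow.dt_cotton (hD : D.Flow) (hg : (D.g.map χ).PosDef) (i j : Fin 3) :
    χ (D.dt (D.cotton i j)) = χ (D.cottonEvolution i j) := by
  obtain ⟨E, F, hEF, hE⟩ := hg.exists_congr_one
  let P := D.constGL E F hEF
  have hPE : P.E.map χ = E := by ext; simp [P, constGL]
  have hconj : ∀ X, (P.conj X).map χ = Eᵀ * X.map χ * E := fun X => by
    rw [ConstGL.conj, map_mul_algHom, map_mul_algHom, Matrix.transpose_map, hPE]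
  have hg' : P.change.g.map χ = 1 := by
    rw [← hE, ← hconj]; rfl
  -- Both sides are tensorial, so the identity in the adapted coordinates is a congruence by `E` of
  -- the one sought, and `F` undoes it.
  have h : (P.conj (mapDer D.dt D.cotton)).map χ = (P.conj D.cottonEvolution).map χ := by
    rw [← P.dt_cotton_change, ← P.cottonEvolution_change]
    ext a b
    exact (P.flow_change hD).map_dt_cotton χ hg' a b
  rw [hconj, hconj] at h
  have hFE : F * E = 1 := mul_eq_one_comm.mp hEF
  have hc : ∀ X : Matrix (Fin 3) (Fin 3) ℝ, Fᵀ * (Eᵀ * X * E) * F = X := fun X => by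
    calc _ = (E * F)ᵀ * X * (E * F) := by rw [Matrix.transpose_mul]; noncomm_ring
      _ = X := by rw [hEF]; simp
  have h2 := congrArg (fun X => Fᵀ * X * F) h
  simp only [hc] at h2
  exact congrFun (congrFun h2 i) j

end MetricData
end CottonYork

namespace CottonYork

/-! ### Smooth functions on a set as a differential algebra. -/

section SmoothFunctions

variable {X : Type*} {S : Set X}

/-- Extension by zero of a function on a set. -/
noncomputable def extendZero (f : S → ℝ) (p : X) : ℝ :=
  open Classical in if h : p ∈ S then f ⟨p, h⟩ else 0

theorem extendZero_apply (f : S → ℝ) (p : X) (hp : p ∈ S) : extendZero f p = f ⟨p, hp⟩ :=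
  dif_pos hp

/-- Smoothness on `S` and derivatives within `S` see only the values on `S`, so the choice of zero
outside is harmless. -/
theorem extendZero_restrict (F : X → ℝ) : Set.EqOn (extendZero fun p : S => F p) F S :=
  fun p hp => extendZero_apply _ p hp

theorem extendZero_add (f g : S → ℝ) : extendZero (f + g) = extendZero f + extendZero g := by
  funext p; by_cases h : p ∈ S <;> simp [extendZero, h]

theorem extendZero_mul (f g : S → ℝ) : extendZero (f * g) = extendZero f * extendZero g := by
  funext p; by_cases h : p ∈ S <;> simp [extendZero, h]

theorem extendZero_smul (c : ℝ) (f : S → ℝ) : extendZero (c • f) = c • extendZero f := by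
  funext p; by_cases h : p ∈ S <;> simp [extendZero, h]

variable [NormedAddCommGroup X] [NormedSpace ℝ X]

variable (S) in
/-- The algebra of smooth functions on a set. -/
def smoothFun : Subalgebra ℝ (S → ℝ) where
  carrier := {f | ContDiffOn ℝ ∞ (extendZero f) S}
  mul_mem' {f g} hf hg := by
    simp only [Set.mem_ofPred_eq, extendZero_mul] at *
    exact hf.mul hg
  add_mem' {f g} hf hg := by
    simp only [Set.mem_ofPred_eq, extendZero_add] at *
    exact hf.add hg
  algebraMap_mem' c := (contDiffOn_const (c := c)).congr (extendZero_restrict fun _ => c)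

/-- The restriction of a function that is smooth on a set. -/
def smoothFun.mk (F : X → ℝ) (hF : ContDiffOn ℝ ∞ F S) : smoothFun S :=
  ⟨fun p => F p, hF.congr (extendZero_restrict F)⟩

theorem smoothFun.contDiffOn (f : smoothFun S) : ContDiffOn ℝ ∞ (extendZero f.1) S := f.2

theorem smoothFun.differentiableWithinAt (f : smoothFun S) {p : X} (hp : p ∈ S) :
    DifferentiableWithinAt ℝ (extendZero f.1) S p :=
  ((smoothFun.contDiffOn f) p hp).differentiableWithinAt (by simp)

/-- Evaluation of smooth functions at a point. -/
def smoothFun.eval (p : S) : smoothFun S →ₐ[ℝ] ℝ :=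
  (Pi.evalAlgHom ℝ (fun _ : S => ℝ) p).comp (smoothFun S).val

theorem smoothFun.ext_eval {f g : smoothFun S}
    (h : ∀ p, smoothFun.eval p f = smoothFun.eval p g) : f = g :=
  Subtype.ext (funext h)

/-- Directional derivatives of smooth functions on a set. -/
noncomputable def smoothDer (hS : UniqueDiffOn ℝ S) (v : X) :
    Derivation ℝ (smoothFun S) (smoothFun S) :=
  Derivation.mk'
    { toFun := fun f => smoothFun.mk (fun p => fderivWithin ℝ (extendZero f.1) S p v)
        (((smoothFun.contDiffOn f).fderivWithin hS (by simp)).clm_apply contDiffOn_const)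
      map_add' := fun f g => Subtype.ext <| funext fun p => by
        change fderivWithin ℝ (extendZero (f.1 + g.1)) S p v = _
        rw [extendZero_add, fderivWithin_add (hS p p.2) (smoothFun.differentiableWithinAt f p.2)
          (smoothFun.differentiableWithinAt g p.2)]
        rfl
      map_smul' := fun c f => Subtype.ext <| funext fun p => by
        change fderivWithin ℝ (extendZero (c • f.1)) S p v = _
        rw [extendZero_smul, fderivWithin_const_smul (hS p p.2)
          (smoothFun.differentiableWithinAt f p.2) c]
        rfl }
    fun f g => Subtype.ext <| funext fun p => by
      change fderivWithin ℝ (extendZero (f.1 * g.1)) S p v = _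
      rw [extendZero_mul, fderivWithin_mul (hS p p.2) (smoothFun.differentiableWithinAt f p.2)
        (smoothFun.differentiableWithinAt g p.2)]
      simp only [extendZero_apply _ _ p.2]
      rfl

theorem eval_smoothDer (hS : UniqueDiffOn ℝ S) (v : X) (f : smoothFun S) (p : S) :
    smoothFun.eval p (smoothDer hS v f) = fderivWithin ℝ (extendZero f.1) S p v := rfl

/-- Symmetry of the second derivative within `S`; at boundary points, such as endpoints of the time
interval, it is inherited from the interior by closure. -/
theorem smoothDer_comm (hS : UniqueDiffOn ℝ S) (hS' : S ⊆ closure (interior S)) (v w : X)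
    (f : smoothFun S) :
    smoothDer hS v (smoothDer hS w f) = smoothDer hS w (smoothDer hS v f) := by
  have h : ∀ (v w : X) (p : S), fderivWithin ℝ (extendZero (smoothDer hS w f).1) S p v
      = fderivWithin ℝ (fderivWithin ℝ (extendZero f.1) S) S p v w := fun v w p => by
    have e : Set.EqOn (extendZero (smoothDer hS w f).1)
        (fun q => fderivWithin ℝ (extendZero f.1) S q w) S :=
      fun p hp => extendZero_apply _ p hp
    have hd : DifferentiableWithinAt ℝ (fderivWithin ℝ (extendZero f.1) S) S p :=
      (((smoothFun.contDiffOn f).fderivWithin (m := ∞) hS (by simp)) p p.2).differentiableWithinAt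
        (by simp)
    rw [fderivWithin_congr e (e p.2),
      fderivWithin_clm_apply (hS p p.2) hd (differentiableWithinAt_const w)]
    simp
  refine smoothFun.ext_eval fun p => ?_
  rw [eval_smoothDer, eval_smoothDer, h, h]
  exact ((smoothFun.contDiffOn f) p p.2).isSymmSndFDerivWithinAt
    (by rw [minSmoothness_of_isRCLikeNormedField]; exact WithTop.coe_le_coe.mpr le_top)
    hS (hS' p.2) p.2 v w

/-- The inverse square root of a positive smooth function. -/
noncomputable def smoothFun.invSqrt (f : smoothFun S) (hf : ∀ p, 0 < smoothFun.eval p f) :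
    smoothFun S :=
  smoothFun.mk (fun p => (Real.sqrt (extendZero f.1 p))⁻¹) <| by
    have h : ∀ p ∈ S, 0 < extendZero f.1 p := fun p hp => by
      rw [extendZero_apply _ _ hp]; exact hf ⟨p, hp⟩
    exact ((smoothFun.contDiffOn f).sqrt fun p hp => (h p hp).ne').inv
      fun p hp => (Real.sqrt_pos.mpr (h p hp)).ne'

theorem smoothFun.eval_invSqrt (f : smoothFun S) (hf : ∀ p, 0 < smoothFun.eval p f) (p : S) :
    smoothFun.eval p (smoothFun.invSqrt f hf) = (Real.sqrt (smoothFun.eval p f))⁻¹ := by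
  change (Real.sqrt (extendZero f.1 p))⁻¹ = _
  rw [extendZero_apply _ _ p.2]; rfl

end SmoothFunctions

/-! ### Derivations of space-time functions as coordinate derivatives. -/

section SpaceTime

variable {J : Set ℝ} {U : Set E3}

/-- The point of space-time with given time and position. -/
def stPoint {s : ℝ} {z : E3} (hs : s ∈ J) (hz : z ∈ U) : ↥(J ×ˢ U) := ⟨(s, z), hs, hz⟩

/-- Chain rule along the slice at time `s`. Openness of `U` turns the derivative within `U` into the
full one used by `pd`, although `s` may be an endpoint of `J`. -/
theorem pd_eq_eval (hS : UniqueDiffOn ℝ (J ×ˢ U)) (hU : IsOpen U) {s : ℝ} (hs : s ∈ J)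
    (f : smoothFun (J ×ˢ U)) (F : E3 → ℝ)
    (hF : ∀ z (hz : z ∈ U), F z = smoothFun.eval (stPoint hs hz) f) (k : Fin 3) (z : E3)
    (hz : z ∈ U) :
    pd k F z = smoothFun.eval (stPoint hs hz)
      (smoothDer hS ((0 : ℝ), EuclideanSpace.single k (1 : ℝ)) f) := by
  have h1 : HasFDerivWithinAt (fun z' : E3 => extendZero f.1 (s, z'))
      ((fderivWithin ℝ (extendZero f.1) (J ×ˢ U) (s, z)).comp
        (ContinuousLinearMap.inr ℝ ℝ E3)) U z :=
    HasFDerivWithinAt.comp z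
      (smoothFun.differentiableWithinAt f (p := (s, z)) ⟨hs, hz⟩).hasFDerivWithinAt
      (hasFDerivAt_prodMk_right s z).hasFDerivWithinAt fun z' hz' => ⟨hs, hz'⟩
  have h2 : HasFDerivAt F _ z :=
    (h1.congr (fun z' hz' => by
      rw [hF z' hz', extendZero_apply f.1 (s, z') (Set.mk_mem_prod hs hz')]; rfl)
      (by rw [hF z hz, extendZero_apply f.1 (s, z) (Set.mk_mem_prod hs hz)]; rfl)).hasFDerivAt
      (hU.mem_nhds hz)
  rw [pd, h2.fderiv]
  rfl

theorem hasDerivWithinAt_eval (hS : UniqueDiffOn ℝ (J ×ˢ U)) {y : E3} (hy : y ∈ U)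
    (f : smoothFun (J ×ˢ U)) (F : ℝ → ℝ)
    (hF : ∀ s (hs : s ∈ J), F s = smoothFun.eval (stPoint hs hy) f) (t : ℝ) (ht : t ∈ J) :
    HasDerivWithinAt F (smoothFun.eval (stPoint ht hy)
      (smoothDer hS ((1 : ℝ), (0 : E3)) f)) J t := by
  have h1 : HasFDerivWithinAt (fun s : ℝ => extendZero f.1 (s, y))
      ((fderivWithin ℝ (extendZero f.1) (J ×ˢ U) (t, y)).comp
        (ContinuousLinearMap.inl ℝ ℝ E3)) J t :=
    HasFDerivWithinAt.comp (f := fun s : ℝ => (s, y)) t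
      (smoothFun.differentiableWithinAt f (Set.mk_mem_prod ht hy)).hasFDerivWithinAt
      (hasFDerivAt_prodMk_left (𝕜 := ℝ) t y).hasFDerivWithinAt fun s hs => Set.mk_mem_prod hs hy
  exact h1.hasDerivWithinAt.congr (fun s hs => by
    rw [hF s hs, extendZero_apply f.1 (s, y) (Set.mk_mem_prod hs hy)]; rfl)
    (by rw [hF t ht, extendZero_apply f.1 (t, y) (Set.mk_mem_prod ht hy)]; rfl)

end SpaceTime
end CottonYork

namespace CottonYork

open Matrix

/-! ### The Levi-Civita connection over an algebra with derivations. -/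

section LeviCivita

variable {A : Type*} [CommRing A] [Algebra ℝ A]

/-- The Levi-Civita connection of a metric over an algebra with derivations. -/
noncomputable def leviCivita (d : Fin 3 → Derivation ℝ A A) (g gi : Matrix (Fin 3) (Fin 3) A)
    (i : Fin 3) : Matrix (Fin 3) (Fin 3) A :=
  Matrix.of fun k j => algebraMap ℝ A (1 / 2) *
    ∑ l, gi k l * (d i (g j l) + d j (g i l) - d l (g i j))

variable (d : Fin 3 → Derivation ℝ A A) {g gi : Matrix (Fin 3) (Fin 3) A}

theorem leviCivita_symm (hg : gᵀ = g) (i j k : Fin 3) :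
    leviCivita d g gi i k j = leviCivita d g gi j k i := by
  have h : ∀ i j, g i j = g j i := fun i j => congrFun (congrFun hg j) i
  simp only [leviCivita, Matrix.of_apply, h j i]
  congr 1
  exact Finset.sum_congr rfl fun l _ => by ring

theorem mul_leviCivita (h : g * gi = 1) (i l j : Fin 3) :
    (g * leviCivita d g gi i) l j
      = algebraMap ℝ A (1 / 2) * (d i (g j l) + d j (g i l) - d l (g i j)) := by
  have e : leviCivita d g gi i = gi * Matrix.of fun l j =>
      algebraMap ℝ A (1 / 2) * (d i (g j l) + d j (g i l) - d l (g i j)) := by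
    ext k j
    simp only [leviCivita, Matrix.of_apply, Matrix.mul_apply, Finset.mul_sum]
    exact Finset.sum_congr rfl fun l _ => by ring
  rw [e, ← mul_assoc, h, one_mul, Matrix.of_apply]

theorem leviCivita_compat (hg : gᵀ = g) (h : g * gi = 1) (k : Fin 3) :
    mapDer (d k) g = (leviCivita d g gi k)ᵀ * g + g * leviCivita d g gi k := by
  have hs : ∀ i j, g i j = g j i := fun i j => congrFun (congrFun hg j) i
  have e : (leviCivita d g gi k)ᵀ * g = (g * leviCivita d g gi k)ᵀ := by
    rw [Matrix.transpose_mul, hg]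
  have h2 : algebraMap ℝ A (1 / 2) * 2 = 1 := by
    rw [← map_ofNat (algebraMap ℝ A) 2, ← map_mul]; norm_num
  ext i j
  rw [e, Matrix.add_apply, Matrix.transpose_apply, mul_leviCivita d h, mul_leviCivita d h,
    mapDer_apply, hs j i, hs k i, hs k j]
  linear_combination -(d k (g i j)) * h2

end LeviCivita

/-! ### Time slices of the space-time metric data. -/

section Model

variable {J : Set ℝ} {U : Set E3}

/-- The metric data on space-time of a time-dependent metric given in coordinates. -/
noncomputable def metricData (hS : UniqueDiffOn ℝ (J ×ˢ U))
    (hS' : J ×ˢ U ⊆ closure (interior (J ×ˢ U)))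
    (g : Matrix (Fin 3) (Fin 3) (smoothFun (J ×ˢ U))) (hg : gᵀ = g)
    (hpos : ∀ p, 0 < smoothFun.eval p g.det) : MetricData (smoothFun (J ×ˢ U)) :=
  have hw : smoothFun.invSqrt g.det hpos * smoothFun.invSqrt g.det hpos * g.det = 1 :=
    smoothFun.ext_eval fun p => by
      have h := hpos p
      rw [map_mul, map_mul, smoothFun.eval_invSqrt, map_one, ← mul_inv,
        Real.mul_self_sqrt h.le, inv_mul_cancel₀ h.ne']
  -- Cramer's rule with 1 / det g = w², so the inverse metric is smooth by construction.
  have hgi : g * ((smoothFun.invSqrt g.det hpos * smoothFun.invSqrt g.det hpos) • g.adjugate)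
      = 1 := by
    rw [Matrix.mul_smul, Matrix.mul_adjugate, smul_smul, hw, one_smul]
  { d := fun k => smoothDer hS ((0 : ℝ), EuclideanSpace.single k (1 : ℝ))
    dt := smoothDer hS ((1 : ℝ), (0 : E3))
    d_comm := fun _ _ => smoothDer_comm hS hS' _ _
    dt_comm := fun _ => smoothDer_comm hS hS' _ _
    g := g
    gi := (smoothFun.invSqrt g.det hpos * smoothFun.invSqrt g.det hpos) • g.adjugate
    Γ := leviCivita (fun k => smoothDer hS ((0 : ℝ), EuclideanSpace.single k (1 : ℝ))) g
      ((smoothFun.invSqrt g.det hpos * smoothFun.invSqrt g.det hpos) • g.adjugate)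
    w := smoothFun.invSqrt g.det hpos
    g_symm := hg
    g_mul_gi := hgi
    Γ_symm := fun _ _ _ => leviCivita_symm _ hg _ _ _
    compat := leviCivita_compat
      (fun k => smoothDer hS ((0 : ℝ), EuclideanSpace.single k (1 : ℝ))) hg hgi
    w_sq := hw }

/-- The components `γ` are the time slice at time `s` of the metric data `D`. -/
structure IsSlice (D : MetricData (smoothFun (J ×ˢ U))) (γ : E3 → Matrix (Fin 3) (Fin 3) ℝ)
    {s : ℝ} (hs : s ∈ J) : Prop where
  hS : UniqueDiffOn ℝ (J ×ˢ U)
  hU : IsOpen U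
  d_eq : ∀ k, D.d k = smoothDer hS ((0 : ℝ), EuclideanSpace.single k (1 : ℝ))
  Γ_eq : D.Γ = leviCivita D.d D.g D.gi
  g_eq : ∀ z (hz : z ∈ U) i j, γ z i j = smoothFun.eval (stPoint hs hz) (D.g i j)
  w_eq : ∀ z (hz : z ∈ U), smoothFun.eval (stPoint hs hz) D.w = (Real.sqrt (γ z).det)⁻¹

namespace IsSlice

variable {D : MetricData (smoothFun (J ×ˢ U))} {γ : E3 → Matrix (Fin 3) (Fin 3) ℝ}
  {s : ℝ} {hs : s ∈ J} {z : E3}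

theorem pd_eq (h : IsSlice D γ hs) (hz : z ∈ U) (f : smoothFun (J ×ˢ U)) (F : E3 → ℝ)
    (hF : ∀ z (hz : z ∈ U), F z = smoothFun.eval (stPoint hs hz) f) (k : Fin 3) :
    pd k F z = smoothFun.eval (stPoint hs hz) (D.d k f) := by
  rw [pd_eq_eval h.hS h.hU hs f F hF k z hz, h.d_eq]

theorem inv_eq (h : IsSlice D γ hs) (hz : z ∈ U) (k l : Fin 3) :
    (γ z)⁻¹ k l = smoothFun.eval (stPoint hs hz) (D.gi k l) := by
  have hγ : γ z = D.g.map (smoothFun.eval (stPoint hs hz)) := by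
    ext i j; exact h.g_eq z hz i j
  have : γ z * D.gi.map (smoothFun.eval (stPoint hs hz)) = 1 := by
    rw [hγ, ← MetricData.map_mul_algHom, D.g_mul_gi]
    exact Matrix.map_one _ (map_zero _) (map_one _)
  rw [Matrix.inv_eq_right_inv this]; rfl

theorem christoffel_eq (h : IsSlice D γ hs) (hz : z ∈ U) (k i j : Fin 3) :
    christoffel γ k i j z = smoothFun.eval (stPoint hs hz) (D.Γ i k j) := by
  have hp : ∀ a b c, pd a (fun z => γ z b c) z
      = smoothFun.eval (stPoint hs hz) (D.d a (D.g b c)) := fun a b c =>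
    h.pd_eq hz (D.g b c) _ (fun z hz => h.g_eq z hz b c) a
  simp only [christoffel, hp, h.inv_eq hz, h.Γ_eq, leviCivita, Matrix.of_apply, map_mul, map_sum,
    map_add, map_sub, AlgHom.commutes, Algebra.algebraMap_self, RingHom.id_apply]

theorem riemann_eq (h : IsSlice D γ hs) (hz : z ∈ U) (l i j k : Fin 3) :
    riemann γ l i j k z = smoothFun.eval (stPoint hs hz) (D.rm i j l k) := by
  have hp : ∀ a b c e, pd a (christoffel γ b c e) z
      = smoothFun.eval (stPoint hs hz) (D.d a (D.Γ c b e)) := fun a b c e =>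
    h.pd_eq hz (D.Γ c b e) _ (fun z hz => h.christoffel_eq hz b c e) a
  simp only [riemann, hp, h.christoffel_eq hz, D.rm_apply, map_add, map_sub, map_sum, map_mul,
    Finset.sum_sub_distrib]
  ring

theorem ricci_eq (h : IsSlice D γ hs) (hz : z ∈ U) (j k : Fin 3) :
    ricci γ j k z = smoothFun.eval (stPoint hs hz) (D.ric j k) := by
  simp only [ricci, h.riemann_eq hz, MetricData.ric, Matrix.of_apply, map_sum]

theorem scal_eq (h : IsSlice D γ hs) (hz : z ∈ U) :
    scal γ z = smoothFun.eval (stPoint hs hz) D.scal := by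
  simp only [scal, h.inv_eq hz, h.ricci_eq hz, MetricData.scal, MetricData.contract, map_sum,
    map_mul]

/-- The components must agree on all of `U`, not just at `z`, because they are differentiated. -/
theorem nabla2_eq (h : IsSlice D γ hs) (hz : z ∈ U) {T : Fin 3 → Fin 3 → E3 → ℝ}
    {X : Matrix (Fin 3) (Fin 3) (smoothFun (J ×ˢ U))}
    (hT : ∀ i j z (hz : z ∈ U), T i j z = smoothFun.eval (stPoint hs hz) (X i j))
    (k i j : Fin 3) :
    nabla2 γ T k i j z = smoothFun.eval (stPoint hs hz) (D.cov2 k X i j) := by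
  simp only [nabla2, h.pd_eq hz (X i j) _ (hT i j), h.christoffel_eq hz, hT _ _ z hz,
    D.cov2_apply, map_sub, map_sum, map_mul]

theorem nabla3_eq (h : IsSlice D γ hs) (hz : z ∈ U) {T : Fin 3 → Fin 3 → Fin 3 → E3 → ℝ}
    {X : Fin 3 → Matrix (Fin 3) (Fin 3) (smoothFun (J ×ˢ U))}
    (hT : ∀ k i j z (hz : z ∈ U), T k i j z = smoothFun.eval (stPoint hs hz) (X k i j))
    (l k i j : Fin 3) :
    nabla3 γ T l k i j z = smoothFun.eval (stPoint hs hz) (D.cov3 X l k i j) := by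
  simp only [nabla3, h.pd_eq hz (X k i j) _ (hT k i j), h.christoffel_eq hz, hT _ _ _ z hz,
    D.cov3_apply, map_sub, map_sum, map_mul]

theorem laplacian2_eq (h : IsSlice D γ hs) (hz : z ∈ U) {T : Fin 3 → Fin 3 → E3 → ℝ}
    {X : Matrix (Fin 3) (Fin 3) (smoothFun (J ×ˢ U))}
    (hT : ∀ i j z (hz : z ∈ U), T i j z = smoothFun.eval (stPoint hs hz) (X i j))
    (i j : Fin 3) :
    laplacian2 γ T i j z = smoothFun.eval (stPoint hs hz) (D.lap X i j) := by
  simp only [laplacian2, h.inv_eq hz,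
    h.nabla3_eq hz (X := fun k => D.cov2 k X) (fun k i j z hz => h.nabla2_eq hz hT k i j),
    MetricData.lap, Matrix.sum_apply, Matrix.smul_apply, smul_eq_mul, map_sum, map_mul]

theorem inner2_eq (h : IsSlice D γ hs) (hz : z ∈ U) {T T' : Fin 3 → Fin 3 → E3 → ℝ}
    {X X' : Matrix (Fin 3) (Fin 3) (smoothFun (J ×ˢ U))}
    (hT : ∀ i j z (hz : z ∈ U), T i j z = smoothFun.eval (stPoint hs hz) (X i j))
    (hT' : ∀ i j z (hz : z ∈ U), T' i j z = smoothFun.eval (stPoint hs hz) (X' i j)) :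
    inner2 γ T T' z = smoothFun.eval (stPoint hs hz) (D.inner X X') := by
  have e : D.inner X X'
      = ∑ i, ∑ j, ∑ p, ∑ q, D.gi i p * D.gi j q * X i j * X' p q := by
    simp only [MetricData.inner, Matrix.trace, Matrix.diag_apply, Matrix.mul_apply,
      Matrix.transpose_apply, D.gi_symm_apply _ 0, Fin.sum_univ_three, D.gi_symm_apply 2 1]
    ring
  simp only [inner2, h.inv_eq hz, hT _ _ z hz, hT' _ _ z hz, e, map_sum, map_mul]

/-- The components of the curl of a 3-tensor. -/
theorem sum_eps_eq (h : IsSlice D γ hs) (hz : z ∈ U)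
    (Y : Fin 3 → Matrix (Fin 3) (Fin 3) (smoothFun (J ×ˢ U))) (i j : Fin 3) :
    ∑ k, ∑ l, ∑ m, γ z i k * eps γ k l m z * smoothFun.eval (stPoint hs hz) (Y l m j)
      = smoothFun.eval (stPoint hs hz) (D.curl Y i j) := by
  have e : D.curl Y i j = ∑ k, ∑ l, ∑ m,
      D.g i k * (algebraMap ℝ _ (eta k l m) * D.w) * Y l m j := by
    simp only [MetricData.curl, Matrix.smul_apply, Matrix.sum_apply, Matrix.mul_apply,
      MetricData.etaMat, Matrix.of_apply, smul_eq_mul]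
    simp only [Fin.sum_univ_three]
    ring
  simp only [e, map_sum, map_mul, AlgHom.commutes, Algebra.algebraMap_self, RingHom.id_apply,
    h.w_eq z hz, eps, h.g_eq z hz, div_eq_mul_inv]

theorem cottonYork_eq (h : IsSlice D γ hs) (hz : z ∈ U) (i j : Fin 3) :
    cottonYork γ i j z = smoothFun.eval (stPoint hs hz) (D.cotton i j) := by
  have e : ∀ l m, nabla2 γ (ricci γ) l m j z - (1 / 4) * pd l (scal γ) z * γ z m j
      = smoothFun.eval (stPoint hs hz) (D.preCotton l m j) := fun l m => by
    rw [h.nabla2_eq hz (X := D.ric) fun i j z hz => h.ricci_eq hz i j,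
      h.pd_eq hz D.scal _ fun z hz => h.scal_eq hz, h.g_eq z hz]
    simp only [MetricData.preCotton, MetricData.dRic, Matrix.sub_apply, Matrix.smul_apply,
      smul_eq_mul, map_sub, map_mul, AlgHom.commutes, Algebra.algebraMap_self, RingHom.id_apply]
  simp only [cottonYork, e, h.sum_eps_eq hz, MetricData.cotton]

end IsSlice

end Model
end CottonYork

/-! ### The evolution equation in coordinate form. -/

namespace CottonYork

open Matrix

namespace IsSlice

variable {J : Set ℝ} {U : Set E3} {D : MetricData (smoothFun (J ×ˢ U))}
  {γ : E3 → Matrix (Fin 3) (Fin 3) ℝ} {s : ℝ} {hs : s ∈ J} {z : E3}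

theorem eps_swap_right (γ : E3 → Matrix (Fin 3) (Fin 3) ℝ) (k l m : Fin 3) (z : E3) :
    eps γ k m l z = -eps γ k l m z := by
  rw [eps, eps, eta_swap_right, neg_div]

theorem cottonSource_eq (h : IsSlice D γ hs) (hz : z ∈ U) (l m j : Fin 3) :
    smoothFun.eval (stPoint hs hz) (D.cottonSource l m j)
      = (1 / 2) * pd l (inner2 γ (ricci γ) (ricci γ)) z * γ z m j
        - (1 / 2) * scal γ z * pd l (scal γ) z * γ z m j
        - 2 * ∑ p, ∑ q, (γ z)⁻¹ p q * ricci γ p m z * nabla2 γ (ricci γ) l q j z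
        + pd l (scal γ) z * ricci γ j m z := by
  have e : (D.ricᵀ * D.gi * D.dRic l) m j
      = ∑ p, ∑ q, D.gi p q * D.ric p m * D.cov2 l D.ric q j := by
    simp only [MetricData.dRic, Matrix.mul_apply, Matrix.transpose_apply, Finset.sum_mul]
    rw [Finset.sum_comm]
    exact Finset.sum_congr rfl fun p _ => Finset.sum_congr rfl fun q _ => by ring
  have hric : ∀ i j z (hz : z ∈ U), ricci γ i j z = smoothFun.eval (stPoint hs hz) (D.ric i j) :=
    fun i j z hz => h.ricci_eq hz i j
  rw [h.pd_eq hz _ _ (fun z hz => h.inner2_eq hz hric hric), h.pd_eq hz D.scal _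
    (fun z hz => h.scal_eq hz), h.scal_eq hz]
  simp only [h.g_eq z hz, h.inv_eq hz, h.nabla2_eq hz hric, h.ricci_eq hz,
    MetricData.cottonSource, Matrix.add_apply, Matrix.sub_apply, Matrix.smul_apply, e,
    Matrix.transpose_apply, smul_eq_mul, map_add, map_sub, map_mul, map_sum, map_ofNat,
    AlgHom.commutes, Algebra.algebraMap_self, RingHom.id_apply]

/-- Two of the four terms have the derivative on the index `m`; exchanging `l` and `m` in ε flips
their sign, which explains the minus signs in `cottonSource`. -/
theorem curl_cottonSource_eq (h : IsSlice D γ hs) (hz : z ∈ U) (i j : Fin 3) :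
    smoothFun.eval (stPoint hs hz) (D.curl D.cottonSource i j)
      = (1 / 2) * ∑ k, ∑ l, ∑ m, γ z i k * γ z j m * eps γ k l m z *
            pd l (inner2 γ (ricci γ) (ricci γ)) z
        + (scal γ z / 2) * ∑ k, ∑ l, ∑ m, γ z i k * γ z j l * eps γ k l m z * pd m (scal γ) z
        + 2 * ∑ k, ∑ l, ∑ m, ∑ p, ∑ q, γ z i k * (γ z)⁻¹ p q * eps γ k l m z *
            ricci γ p l z * nabla2 γ (ricci γ) m q j z
        + ∑ k, ∑ l, ∑ m, γ z i k * eps γ k l m z * ricci γ j m z * pd l (scal γ) z := by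
  have hγ : ∀ a b, γ z a b = γ z b a := fun a b => by
    rw [h.g_eq z hz, h.g_eq z hz, D.g_symm_apply]
  have e2 : ∑ k, ∑ l, ∑ m, γ z i k * γ z j l * eps γ k l m z * pd m (scal γ) z
      = ∑ k, ∑ l, ∑ m, -(γ z i k * γ z m j * eps γ k l m z * pd l (scal γ) z) :=
    Finset.sum_congr rfl fun k _ => by
      rw [Finset.sum_comm]
      exact Finset.sum_congr rfl fun l _ => Finset.sum_congr rfl fun m _ => by
        rw [eps_swap_right, hγ j m]; ring
  have e3 : ∑ k, ∑ l, ∑ m, ∑ p, ∑ q, γ z i k * (γ z)⁻¹ p q * eps γ k l m z *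
            ricci γ p l z * nabla2 γ (ricci γ) m q j z
      = ∑ k, ∑ l, ∑ m, -(γ z i k * eps γ k l m z *
          ∑ p, ∑ q, (γ z)⁻¹ p q * ricci γ p m z * nabla2 γ (ricci γ) l q j z) :=
    Finset.sum_congr rfl fun k _ => by
      rw [Finset.sum_comm]
      refine Finset.sum_congr rfl fun l _ => Finset.sum_congr rfl fun m _ => ?_
      simp only [Finset.mul_sum, ← Finset.sum_neg_distrib]
      exact Finset.sum_congr rfl fun p _ => Finset.sum_congr rfl fun q _ => by
        rw [eps_swap_right]; ring
  rw [← h.sum_eps_eq hz, e2, e3]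
  simp only [h.cottonSource_eq hz, Finset.mul_sum, ← Finset.sum_add_distrib]
  refine Finset.sum_congr rfl fun k _ => Finset.sum_congr rfl fun l _ =>
    Finset.sum_congr rfl fun m _ => ?_
  simp only [← Finset.mul_sum]
  rw [hγ j m]
  ring

theorem cottonEvolution_eq (h : IsSlice D γ hs) (hz : z ∈ U) (i j : Fin 3) :
    smoothFun.eval (stPoint hs hz) (D.cottonEvolution i j)
      = laplacian2 γ (cottonYork γ) i j z
        - 5 * ∑ p, ∑ q, (γ z)⁻¹ p q * ricci γ i p z * cottonYork γ q j z
        - 5 * ∑ p, ∑ q, (γ z)⁻¹ p q * cottonYork γ i q z * ricci γ p j z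
        + 2 * inner2 γ (cottonYork γ) (ricci γ) z * γ z i j
        + 4 * scal γ z * cottonYork γ i j z
        + (1 / 2) * ∑ k, ∑ l, ∑ m, γ z i k * γ z j m * eps γ k l m z *
            pd l (inner2 γ (ricci γ) (ricci γ)) z
        + (scal γ z / 2) * ∑ k, ∑ l, ∑ m, γ z i k * γ z j l * eps γ k l m z * pd m (scal γ) z
        + 2 * ∑ k, ∑ l, ∑ m, ∑ p, ∑ q, γ z i k * (γ z)⁻¹ p q * eps γ k l m z *
            ricci γ p l z * nabla2 γ (ricci γ) m q j z
        + ∑ k, ∑ l, ∑ m, γ z i k * eps γ k l m z * ricci γ j m z * pd l (scal γ) z := by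
  have hric : ∀ i j z (hz : z ∈ U), ricci γ i j z = smoothFun.eval (stPoint hs hz) (D.ric i j) :=
    fun i j z hz => h.ricci_eq hz i j
  have hcot : ∀ i j z (hz : z ∈ U),
      cottonYork γ i j z = smoothFun.eval (stPoint hs hz) (D.cotton i j) :=
    fun i j z hz => h.cottonYork_eq hz i j
  have e1 : (D.ric * D.gi * D.cotton) i j
      = ∑ p, ∑ q, D.gi p q * D.ric i p * D.cotton q j := by
    simp only [Matrix.mul_apply, Finset.sum_mul]
    rw [Finset.sum_comm]
    exact Finset.sum_congr rfl fun p _ => Finset.sum_congr rfl fun q _ => by ring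
  have e2 : (D.cotton * D.gi * D.ric) i j
      = ∑ p, ∑ q, D.gi p q * D.cotton i q * D.ric p j := by
    simp only [Matrix.mul_apply, Finset.sum_mul]
    exact Finset.sum_congr rfl fun p _ => Finset.sum_congr rfl fun q _ => by
      rw [D.gi_symm_apply p q]; ring
  have e0 : smoothFun.eval (stPoint hs hz) (D.cottonEvolution i j)
      = laplacian2 γ (cottonYork γ) i j z
        - 5 * ∑ p, ∑ q, (γ z)⁻¹ p q * ricci γ i p z * cottonYork γ q j z
        - 5 * ∑ p, ∑ q, (γ z)⁻¹ p q * cottonYork γ i q z * ricci γ p j z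
        + 2 * inner2 γ (cottonYork γ) (ricci γ) z * γ z i j
        + 4 * scal γ z * cottonYork γ i j z
        + smoothFun.eval (stPoint hs hz) (D.curl D.cottonSource i j) := by
    rw [h.laplacian2_eq hz hcot, h.inner2_eq hz hcot hric, h.scal_eq hz]
    simp only [h.g_eq z hz, h.inv_eq hz, h.ricci_eq hz, h.cottonYork_eq hz,
      MetricData.cottonEvolution, Matrix.add_apply, Matrix.sub_apply, Matrix.smul_apply, e1, e2,
      smul_eq_mul, map_add, map_sub, map_mul, map_sum, map_ofNat]
  rw [e0, h.curl_cottonSource_eq hz]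
  ring

end IsSlice

/-! ### Regularity of the space-time domain. -/

section Domain

variable {J : Set ℝ} {U : Set E3}

theorem uniqueDiffOn_spaceTime (hJ : J.OrdConnected) (hJ' : (interior J).Nonempty)
    (hU : IsOpen U) : UniqueDiffOn ℝ (J ×ˢ U) :=
  (uniqueDiffOn_convex hJ.convex hJ').prod hU.uniqueDiffOn

theorem spaceTime_subset_closure_interior (hJ : J.OrdConnected) (hJ' : (interior J).Nonempty)
    (hU : IsOpen U) : J ×ˢ U ⊆ closure (interior (J ×ˢ U)) := by
  rw [interior_prod_eq, closure_prod_eq,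
    (Set.OrdConnected.convex (𝕜 := ℝ) hJ).closure_interior_eq_closure_of_nonempty_interior hJ',
    hU.interior_eq]
  exact Set.prod_mono subset_closure subset_closure

theorem metricData_isSlice (hS : UniqueDiffOn ℝ (J ×ˢ U))
    (hS' : J ×ˢ U ⊆ closure (interior (J ×ˢ U))) (hU : IsOpen U)
    (g : Matrix (Fin 3) (Fin 3) (smoothFun (J ×ˢ U))) (hg : gᵀ = g)
    (hpos : ∀ p, 0 < smoothFun.eval p g.det) {s : ℝ} (hs : s ∈ J)
    (γ : E3 → Matrix (Fin 3) (Fin 3) ℝ)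
    (hγ : ∀ z (hz : z ∈ U) i j, γ z i j = smoothFun.eval (stPoint hs hz) (g i j)) :
    IsSlice (metricData hS hS' g hg hpos) γ hs where
  hS := hS
  hU := hU
  d_eq _ := rfl
  Γ_eq := rfl
  g_eq := hγ
  w_eq z hz := by
    have e : γ z = g.map (smoothFun.eval (stPoint hs hz)) := by
      ext i j; exact hγ z hz i j
    have e' : (γ z).det = smoothFun.eval (stPoint hs hz) g.det := by
      rw [e]; exact ((smoothFun.eval (stPoint hs hz)).map_det g).symm
    rw [e']
    exact smoothFun.eval_invSqrt g.det hpos _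

end Domain

/-! ### Metric components in a chart. -/

section Manifold

variable {M : Type*} [TopologicalSpace M] [ChartedSpace E3 M]

theorem mfderiv_symm_injective {e : OpenPartialHomeomorph M E3}
    (he : e ∈ IsManifold.maximalAtlas (𝓡 3) ∞ M) {y : E3} (hy : y ∈ e.target) :
    Function.Injective (mfderiv (𝓡 3) (𝓡 3) e.symm y) := by
  have he1 : e ∈ IsManifold.maximalAtlas (𝓡 3) 1 M :=
    IsManifold.maximalAtlas_subset_of_le (by exact_mod_cast le_top) he
  have h : e.MDifferentiable (𝓡 3) (𝓡 3) :=
    ⟨fun x hx => (mdifferentiableAt_of_mem_maximalAtlas he1 hx).mdifferentiableWithinAt,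
      fun x hx => (mdifferentiableAt_symm_of_mem_maximalAtlas he1 hx).mdifferentiableWithinAt⟩
  exact h.symm.mfderiv_injective hy

variable [IsManifold (𝓡 3) ∞ M]

theorem metricComp_transpose
    (g : Bundle.ContMDiffRiemannianMetric (𝓡 3) ∞ E3 (fun x : M => TangentSpace (𝓡 3) x))
    (e : OpenPartialHomeomorph M E3) (y : E3) : (metricComp g e y)ᵀ = metricComp g e y := by
  ext i j
  exact g.symm _ _ _

/-- The component matrix is the Gram matrix of the images of the standard basis under the
differential of the inverse chart, which is injective. -/
theorem metricComp_posDef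
    (g : Bundle.ContMDiffRiemannianMetric (𝓡 3) ∞ E3 (fun x : M => TangentSpace (𝓡 3) x))
    {e : OpenPartialHomeomorph M E3} (he : e ∈ IsManifold.maximalAtlas (𝓡 3) ∞ M) {y : E3}
    (hy : y ∈ e.target) : (metricComp g e y).PosDef := by
  refine Matrix.PosDef.of_dotProduct_mulVec_pos ?_ fun v hv => ?_
  · rw [Matrix.IsHermitian, Matrix.conjTranspose_eq_transpose_of_trivial, metricComp_transpose]
  · let L : E3 →L[ℝ] TangentSpace (𝓡 3) (e.symm y) := mfderiv (𝓡 3) (𝓡 3) e.symm y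
    have hL : Function.Injective L := mfderiv_symm_injective he hy
    have hw : (∑ i, v i • EuclideanSpace.single i (1 : ℝ) : E3) ≠ 0 := fun h0 => hv <| by
      ext j
      have := congrArg (fun x : E3 => x j) h0
      simpa [Finset.sum_apply, Pi.single_apply] using this
    have h1 := g.pos (e.symm y) (L (∑ i, v i • EuclideanSpace.single i (1 : ℝ)))
      fun h0 => hw (hL (h0.trans (map_zero L).symm))
    have h2 : star v ⬝ᵥ metricComp g e y *ᵥ v
        = g.inner (e.symm y) (L (∑ i, v i • EuclideanSpace.single i (1 : ℝ)))
          (L (∑ i, v i • EuclideanSpace.single i (1 : ℝ))) := by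
      simp only [map_sum, map_smul, _root_.sum_apply, _root_.smul_apply,
        smul_eq_mul, dotProduct, Matrix.mulVec, star_trivial, Finset.mul_sum]
      rw [Finset.sum_comm]
      exact Finset.sum_congr rfl fun i _ => Finset.sum_congr rfl fun j _ => by
        simp only [metricComp, Matrix.of_apply]
        change _ * (g.inner (e.symm y) (L _) (L _) * _) = _
        ring
    rw [h2]
    exact h1

end Manifold
end CottonYork

theorem proposition2p3
    {M : Type*} [TopologicalSpace M] [ChartedSpace CottonYork.E3 M] [IsManifold (𝓡 3) ∞ M]
    (J : Set ℝ) (hJ : J.OrdConnected) (hJ' : (interior J).Nonempty)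
    (g : ℝ → Bundle.ContMDiffRiemannianMetric (𝓡 3) ∞ CottonYork.E3
      (fun x : M => TangentSpace (𝓡 3) x))
    (hg : CottonYork.IsRicciFlow J g)
    (e : OpenPartialHomeomorph M CottonYork.E3) (he : e ∈ IsManifold.maximalAtlas (𝓡 3) ∞ M)
    (t : ℝ) (ht : t ∈ J) (y : CottonYork.E3) (hy : y ∈ e.target) (i j : Fin 3) :
    let γ : CottonYork.E3 → Matrix (Fin 3) (Fin 3) ℝ := CottonYork.metricComp (g t) e
    let C : Fin 3 → Fin 3 → CottonYork.E3 → ℝ := CottonYork.cottonYork γ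
    let Ric : Fin 3 → Fin 3 → CottonYork.E3 → ℝ := CottonYork.ricci γ
    let R : CottonYork.E3 → ℝ := CottonYork.scal γ
    let ε : Fin 3 → Fin 3 → Fin 3 → CottonYork.E3 → ℝ := CottonYork.eps γ
    HasDerivWithinAt
      (fun s : ℝ => CottonYork.cottonYork (CottonYork.metricComp (g s) e) i j y)
      (CottonYork.laplacian2 γ C i j y
        - 5 * ∑ p, ∑ q, (γ y)⁻¹ p q * Ric i p y * C q j y
        - 5 * ∑ p, ∑ q, (γ y)⁻¹ p q * C i q y * Ric p j y
        + 2 * CottonYork.inner2 γ C Ric y * γ y i j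
        + 4 * R y * C i j y
        + (1 / 2) * ∑ k, ∑ l, ∑ m, γ y i k * γ y j m * ε k l m y *
            CottonYork.pd l (CottonYork.inner2 γ Ric Ric) y
        + (R y / 2) * ∑ k, ∑ l, ∑ m, γ y i k * γ y j l * ε k l m y * CottonYork.pd m R y
        + 2 * ∑ k, ∑ l, ∑ m, ∑ p, ∑ q, γ y i k * (γ y)⁻¹ p q * ε k l m y *
            Ric p l y * CottonYork.nabla2 γ Ric m q j y
        + ∑ k, ∑ l, ∑ m, γ y i k * ε k l m y * Ric j m y * CottonYork.pd l R y)
      J t := by 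
  intro γ C Ric R ε
  have hS := CottonYork.uniqueDiffOn_spaceTime hJ hJ' e.open_target
  have hS' := CottonYork.spaceTime_subset_closure_interior hJ hJ' e.open_target
  let G : Matrix (Fin 3) (Fin 3) (CottonYork.smoothFun (J ×ˢ e.target)) :=
    Matrix.of fun i j => CottonYork.smoothFun.mk
      (fun p => CottonYork.metricComp (g p.1) e p.2 i j) (hg.smooth e he i j)
  have hG : ∀ p : ↥(J ×ˢ e.target),
      G.map (CottonYork.smoothFun.eval p) = CottonYork.metricComp (g p.1.1) e p.1.2 :=
    fun p => rfl
  have hGpos : ∀ p : ↥(J ×ˢ e.target), (G.map (CottonYork.smoothFun.eval p)).PosDef := fun p => by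
    rw [hG]; exact CottonYork.metricComp_posDef _ he p.2.2
  have hGs : G.transpose = G := by
    refine Matrix.ext fun i j => ?_
    exact CottonYork.smoothFun.ext_eval fun p : ↥(J ×ˢ e.target) =>
      congrFun (congrFun (CottonYork.metricComp_transpose (g p.1.1) e p.1.2) i) j
  have hdet : ∀ p, 0 < CottonYork.smoothFun.eval p G.det := fun p => by
    have h := (hGpos p).det_pos
    rwa [show G.map (CottonYork.smoothFun.eval p) = (CottonYork.smoothFun.eval p).mapMatrix G
      from rfl, ← AlgHom.map_det] at h
  let D := CottonYork.metricData hS hS' G hGs hdet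
  have hD : ∀ {s : ℝ} (hs : s ∈ J),
      CottonYork.IsSlice D (CottonYork.metricComp (g s) e) hs := fun hs =>
    CottonYork.metricData_isSlice hS hS' e.open_target G hGs hdet hs _ fun _ _ _ _ => rfl
  have hflow : D.Flow := by
    refine Matrix.ext fun i j => ?_
    refine CottonYork.smoothFun.ext_eval fun p => ?_
    obtain ⟨⟨s, z⟩, hs, hz⟩ := p
    have h1 := CottonYork.hasDerivWithinAt_eval hS hz (G i j)
      (fun s => CottonYork.metricComp (g s) e z i j) (fun _ _ => rfl) s hs
    -- The algebraic time derivation and the flow hypothesis give two derivatives of the same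
    -- component within `J`; they agree because a nondegenerate interval has unique derivatives,
    -- endpoints included.
    have h2 := (uniqueDiffOn_convex hJ.convex hJ' s hs).eq_deriv J h1
      (hg.flow e he s hs z hz i j)
    rw [(hD hs).ricci_eq hz] at h2
    refine h2.trans ?_
    rw [Matrix.smul_apply, smul_eq_mul, map_mul, map_neg, map_ofNat]
    rfl
  have h := CottonYork.hasDerivWithinAt_eval hS hy (D.cotton i j)
    (fun s => CottonYork.cottonYork (CottonYork.metricComp (g s) e) i j y)
    (fun s hs => (hD hs).cottonYork_eq hy i j) t ht
  have h' := hflow.dt_cotton (CottonYork.smoothFun.eval (CottonYork.stPoint ht hy)) (hGpos _) i j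
  rw [(hD ht).cottonEvolution_eq hy] at h'
  exact h' ▸ h
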